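/- Let $\mathcal X$ be a Polish space and let $K\ge 1$ and $1=\alpha_1\ge\alpha_2\ge\cdots\ge\alpha_K\ge 0$. Let $\{\mu^{t}\}_{t\in(0,\infty)}$ be Borel probability measures on $\mathcal X$, $\mu^{t}$ having a density $g^{t}:\mathcal X\to[0,\infty)$ with respect to a common $\sigma$-finite reference measure $\gamma$; if some $\alpha_j=0$, let also a probability measure $\mu^{\infty}$ with density $g^{\infty}$ be given, and read $\varepsilon/0=\infty$. Let $I:\mathcal X\to[0,\infty]$ be a rate function ($\{I\le M\}$ is compact for every $M\in[0,\infty)$) that is continuous on its domain of finiteness $\{I<\infty\}$, and suppose that $\{\mu^{\varepsilon}\}$ satisfies the large deviation principle with rate function $I$ as $\varepsilon\downarrow 0$: $\limsup_{\varepsilon\to0}\varepsilon\log\mu^\varepsilon(C)\le-\inf_C I$ for closed $C$ and $\liminf_{\varepsilon\to0}\varepsilon\log\mu^\varepsilon(U)\ge-\inf_U I$ for open $U$. For $\mathbf x\in\mathcal X^K$ and a permutation $\sigma\in\Sigma_K$ write $\mathbf x_\sigma=(x_{\sigma(1)},\dots,x_{\sigma(K)})$ and put $$\rho^{\varepsilon}(\mathbf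 x;\boldsymbol\alpha)=\frac{e^{-\frac1\varepsilon\sum_{j}\alpha_jI(x_j)}}{\sum_{\tau\in\Sigma_K}e^{-\frac1\varepsilon\sum_{j}\alpha_jI(x_{\tau(j)})}},\qquad \tilde\rho^{\varepsilon}(\mathbf x;\boldsymbol\alpha)=\frac{\prod_{j}g^{\varepsilon/\alpha_j}(x_j)}{\sum_{\tau\in\Sigma_K}\prod_{j}g^{\varepsilon/\alpha_j}(x_{\tau(j)})}$$ (with $e^{-\infty}=0$, $0\cdot\infty=0$, and a weight being $0$ where its denominator vanishes). Let $\mathbf X^\varepsilon=(X_1^\varepsilon,\dots,X_K^\varepsilon)$ have independent components with $X_j^\varepsilon\sim\mu^{\varepsilon/\alpha_j}$, let $F^\varepsilon:\mathcal X\to\mathbb R$ be measurable, and let $$\tilde\eta^\varepsilon(\mathbf X^\varepsilon;\boldsymbol\alpha)=\sum_{\sigma\in\Sigma_K}\tilde\rho^\varepsilon(\mathbf X^\varepsilon_\sigma;\boldsymbol\alpha)\,e^{-\frac1\varepsilon F^\varepsilon(X^\varepsilon_{\sigma(1)})}.$$ Let $F:\mathcal X\to\mathbb R$ be continuous and bounded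 below. Suppose that, as $\varepsilon\downarrow0$, $\varepsilon\log(\tilde\rho^\varepsilon/\rho^\varepsilon)\to0$ uniformly on each compact subset of $\mathcal X^K$ (on each compact set, for all small $\varepsilon$, the two weights vanish at the same points, where nothing more is required), that $F^\varepsilon\to F$ uniformly on each compact subset of $\mathcal X$, and that $\inf_{\varepsilon\in(0,1)}\inf_{x\in\mathcal X}F^\varepsilon(x)>-\infty$. Then $$\lim_{\varepsilon\to0}-\varepsilon\log E\big[\tilde\eta^\varepsilon(\mathbf X^\varepsilon;\boldsymbol\alpha)^2\big]=V_F(\boldsymbol\alpha),$$ where $$V_F(\boldsymbol\alpha)=\inf\Big\{2\sum_{j=1}^K\alpha_jI_j+2F(x)-\min_{\sigma\in\Sigma_K}\sum_{j=1}^K\alpha_jI_{\sigma(j)}\;:\;x\in\mathcal X,\ I_1=I(x)<\infty,\ I_j\in[0,I_1]\text{ for }j\ge2\Big\}.$$ -/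

import Mathlib

open Filter MeasureTheory Topology
open scoped ENNReal NNReal

noncomputable section

namespace INS

/-- `I` is a rate function: all its sublevel sets at finite heights are compact. -/
def IsRateFunction {S : Type*} [TopologicalSpace S] (I : S → ℝ≥0∞) : Prop :=
  ∀ M : ℝ≥0, IsCompact {x | I x ≤ M}

/-- The family `ν ε`, `ε ↓ 0`, satisfies the large deviation principle with rate function `I`
and scaling `ε`. The logarithm is extended-real valued (`log 0 = -∞`). -/
structure SatisfiesLDP {S : Type*} [TopologicalSpace S] [MeasurableSpace S]
    (ν : ℝ → Measure S) (I : S → ℝ≥0∞) : Prop where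
  rate : IsRateFunction I
  upper : ∀ C : Set S, IsClosed C →
    limsup (fun ε : ℝ => (ε : EReal) * ENNReal.log (ν ε C)) (𝓝[>] 0)
      ≤ -(⨅ x ∈ C, (I x : EReal))
  lower : ∀ U : Set S, IsOpen U →
    -(⨅ x ∈ U, (I x : EReal))
      ≤ liminf (fun ε : ℝ => (ε : EReal) * ENNReal.log (ν ε U)) (𝓝[>] 0)

/-- The temperature `ε / α`, an element of `(0, ∞]` when `ε > 0`; it is `∞` exactly for `α ≤ 0`. -/
def temp (ε α : ℝ) : ℝ≥0∞ := ENNReal.ofReal ε / ENNReal.ofReal α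

/-- `e ^ (-s)` for `s ∈ [0, ∞]`, with `e ^ (-∞) = 0`. -/
def expNeg (s : ℝ≥0∞) : ℝ := if s = ∞ then 0 else Real.exp (-s.toReal)

section Weights

variable {S : Type*} {K : ℕ}

/-- `w (x) / ∑ τ, w (x_τ)`, where `x_τ = (x_{τ(1)}, …, x_{τ(K)})`;
it is `0` where the denominator vanishes. -/
def symWeight (w : (Fin K → S) → ℝ) (x : Fin K → S) : ℝ :=
  w x / ∑ τ : Equiv.Perm (Fin K), w (fun j => x (τ j))

/-- The weight `ρ^ε (x; α)` built from the rate function `I`. -/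
def rho (I : S → ℝ≥0∞) (α : Fin K → ℝ) (ε : ℝ) : (Fin K → S) → ℝ :=
  symWeight fun x => expNeg (∑ j, ENNReal.ofReal (α j / ε) * I (x j))

/-- The weight `ρ̃^ε (x; α)` built from the densities `g^{ε/α_j}`. -/
def rhoTilde (g : ℝ≥0∞ → S → ℝ≥0) (α : Fin K → ℝ) (ε : ℝ) : (Fin K → S) → ℝ :=
  symWeight fun x => ∏ j, (g (temp ε (α j)) (x j) : ℝ)

/-- A single sample of the generalized INS estimator, as a function of the sample point `x`:
`η̃^ε (x; α) = ∑ σ, ρ̃^ε (x_σ; α) e ^ (-F^ε (x_{σ(1)}) / ε)`. -/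
def etaTilde [NeZero K] (g : ℝ≥0∞ → S → ℝ≥0) (Fε : ℝ → S → ℝ) (α : Fin K → ℝ) (ε : ℝ)
    (x : Fin K → S) : ℝ :=
  ∑ σ : Equiv.Perm (Fin K),
    rhoTilde g α ε (fun j => x (σ j)) * Real.exp (-(1 / ε) * Fε ε (x (σ 0)))

/-- `ε log (ρ̃^ε / ρ^ε) → 0` as `ε ↓ 0`, uniformly on each compact subset of the product space.
The logarithm has to be finite: either both weights are positive, or both vanish, in which case
the quotient imposes no further condition (`Real.log 0 = 0`). -/
def LogRatioTendstoZero [TopologicalSpace S] (I : S → ℝ≥0∞) (g : ℝ≥0∞ → S → ℝ≥0)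
    (α : Fin K → ℝ) : Prop :=
  ∀ C : Set (Fin K → S), IsCompact C → ∀ δ : ℝ, 0 < δ → ∀ᶠ ε in 𝓝[>] (0 : ℝ), ∀ x ∈ C,
    (rhoTilde g α ε x = 0 ↔ rho I α ε x = 0) ∧
      |ε * Real.log (rhoTilde g α ε x / rho I α ε x)| < δ

/-- `V_F (α)`: the infimum of
`2 ∑ j, α_j I_j + 2 F - min_σ ∑ j, α_j I_{σ(j)}` over `(I_1, F) ∈ {(I x, F x)}` with `I_1 < ∞`
and over `I_j ∈ [0, I_1]`, `j ≥ 2`. -/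
def V [NeZero K] (I : S → ℝ≥0∞) (F : S → ℝ) (α : Fin K → ℝ) : EReal :=
  ⨅ (v : Fin K → ℝ≥0) (f : ℝ)
    (_ : ((v 0 : ℝ≥0∞), f) ∈ Set.range fun x => (I x, F x)) (_ : ∀ j, v j ≤ v 0),
    ((2 * ∑ j, α j * (v j : ℝ) + 2 * f
      - Finset.univ.inf' Finset.univ_nonempty
          (fun σ : Equiv.Perm (Fin K) => ∑ j, α j * (v (σ j) : ℝ)) : ℝ) : EReal)

/-- The second moment `E (η̃^ε (X^ε; α))²`, where `X^ε = (X_1^ε, …, X_K^ε)` has independent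
components with `X_j^ε ∼ μ^{ε/α_j}`. -/
def secondMoment [NeZero K] [MeasurableSpace S] (μ : ℝ≥0∞ → Measure S) (g : ℝ≥0∞ → S → ℝ≥0)
    (Fε : ℝ → S → ℝ) (α : Fin K → ℝ) (ε : ℝ) : ℝ≥0∞ :=
  ∫⁻ x, ENNReal.ofReal (etaTilde g Fε α ε x ^ 2) ∂(Measure.pi fun j => μ (temp ε (α j)))

end Weights

end INS

end

/-! Let w be the product of the densities. Since ρ̃(x) times the sum of w over all rearrangements of
x equals w(x), permuting variables gives Σ_σ E[(ρ̃(X_σ) e^{-F^ε(X_σ(1))/ε})²] = E[ρ̃(X)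
e^{-2F^ε(X_1)/ε}], the quantity `weightedMoment`. The square of a sum of K! nonnegative terms lies
between the sum of their squares and K! times it, so the second moment and `weightedMoment` have the
same exponential rate.

On the exponential scale X is near x with probability e^{-Σ α_j I(x_j)/ε}, and ρ̃(x) has exponent
min_σ Σ α_j I(x_σ(j)) - Σ α_j I(x_j). A Laplace argument then suggests the rate inf {`cost` of
(I(x_j)) + 2F(x_1)} over points x. In contrast, `V` requires I_j ≤ I_1 and admits values I_j that I
need not attain. Both discrepancies disappear by `cost_eq_add`: one permutation sorts a vector and
the two pieces obtained by cutting it at a height, so the cost is additive. Hence truncation at I_1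
does not raise the cost (`cost_min_le`), and slicing into layers shows that entries in {0, I_1}
suffice (`exists_mul_cost_indicator_le`); such entries are attained because I has a zero.

Coordinates with α_j = 0 follow a fixed law, which need not concentrate on compact sets where the
hypotheses apply. For the upper bound, `rhoTilde_le` keeps in the denominator of ρ̃ only one
permutation fixing these coordinates; they cancel from the resulting quotient of densities and may
be moved to a zero of I. For the lower bound, `eventually_le_measure_nhds` shows that the relevant
neighbourhoods have positive mass under that law. -/

noncomputable section

namespace INS

/-! ### Uniformity on compact sets and neighbourhoods -/

section Topology

/-- A property that holds eventually uniformly on compact sets holds eventually locally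
uniformly. -/
lemma eventually_prod_nhds_of_forall_isCompact {Y : Type*} [TopologicalSpace Y]
    [FirstCountableTopology Y] {l : Filter ℝ} [l.IsCountablyGenerated] {P : ℝ → Y → Prop}
    (h : ∀ C : Set Y, IsCompact C → ∀ᶠ ε in l, ∀ x ∈ C, P ε x) (y : Y) :
    ∀ᶠ p in l ×ˢ 𝓝 y, P p.1 p.2 := by
  by_contra hcon
  -- A failure yields a sequence of parameters along `l` and points converging to `y`; these points
  -- together with `y` form a compact set, on which the property holds eventually.
  obtain ⟨u, hu, hP⟩ := exists_seq_forall_of_frequently (not_eventually.1 hcon)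
  have h1 : Tendsto (fun n => (u n).1) atTop l := tendsto_fst.comp hu
  have h2 : Tendsto (fun n => (u n).2) atTop (𝓝 y) := tendsto_snd.comp hu
  obtain ⟨n, hn⟩ := (h1.eventually (h _ h2.isCompact_insert_range)).exists
  exact hP n (hn _ (Set.mem_insert_of_mem _ ⟨n, rfl⟩))

/-- A property that holds eventually uniformly on compact sets holds eventually uniformly on a
neighbourhood of each compact set. -/
lemma exists_isOpen_of_forall_isCompact {Y : Type*} [TopologicalSpace Y]
    [FirstCountableTopology Y] {l : Filter ℝ} [l.IsCountablyGenerated] {P : ℝ → Y → Prop}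
    (h : ∀ C : Set Y, IsCompact C → ∀ᶠ ε in l, ∀ x ∈ C, P ε x) {C : Set Y} (hC : IsCompact C) :
    ∃ O, IsOpen O ∧ C ⊆ O ∧ ∀ᶠ ε in l, ∀ x ∈ O, P ε x := by
  refine hC.induction_on (p := fun C => ∃ O, IsOpen O ∧ C ⊆ O ∧ ∀ᶠ ε in l, ∀ x ∈ O, P ε x)
    ⟨∅, isOpen_empty, subset_rfl, by simp⟩ ?_ ?_ ?_
  · rintro s t hst ⟨O, hO, htO, hP⟩
    exact ⟨O, hO, hst.trans htO, hP⟩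
  · rintro s t ⟨O, hO, hsO, hP⟩ ⟨O', hO', htO, hP'⟩
    refine ⟨O ∪ O', hO.union hO', Set.union_subset_union hsO htO, ?_⟩
    filter_upwards [hP, hP'] with ε h1 h2 x hx
    exact hx.elim (h1 x) (h2 x)
  · intro y _
    have hy := eventually_prod_nhds_of_forall_isCompact h y
    rw [eventually_prod_iff] at hy
    obtain ⟨pa, ha, pb, hb, hab⟩ := hy
    obtain ⟨O, hO, hOo, hyO⟩ := eventually_nhds_iff.1 hb
    exact ⟨O, mem_nhdsWithin_of_mem_nhds (hOo.mem_nhds hyO), O, hOo, subset_rfl,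
      ha.mono fun ε hε x hx => hab hε (hO x hx)⟩

/-- Tube lemma for finite powers of a compact set. -/
lemma exists_isOpen_pi_subset {X ι : Type*} [TopologicalSpace X] [TopologicalSpace.MetrizableSpace X]
    [Fintype ι] {C : Set X} (hC : IsCompact C) {O : Set (ι → X)} (hO : IsOpen O)
    (hCO : (Set.univ.pi fun _ => C) ⊆ O) :
    ∃ U, IsOpen U ∧ C ⊆ U ∧ (Set.univ.pi fun _ => U) ⊆ O := by
  let := TopologicalSpace.metrizableSpaceMetric X
  obtain ⟨δ, hδ, h⟩ := (isCompact_univ_pi fun _ : ι => hC).exists_thickening_subset_open hO hCO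
  refine ⟨Metric.thickening δ C, Metric.isOpen_thickening, Metric.self_subset_thickening hδ C,
    fun x hx => h ?_⟩
  choose z hz hxz using fun i => Metric.mem_thickening_iff.1 (hx i trivial)
  exact Metric.mem_thickening_iff.2 ⟨z, fun i _ => hz i, (dist_pi_lt_iff hδ).2 hxz⟩

end Topology

/-! ### Logarithmic limits as exponential bounds -/

section ExponentialScale

lemma log_scaled_le_iff {ε : ℝ} (hε : 0 < ε) (m : ℝ≥0∞) (a : ℝ) :
    (ε : EReal) * ENNReal.log m ≤ a ↔ m ≤ ENNReal.ofReal (Real.exp (a / ε)) := by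
  rw [← ENNReal.log_le_log_iff (x := m), ENNReal.log_ofReal_of_pos (Real.exp_pos _), Real.log_exp,
    EReal.coe_div, EReal.le_div_iff_mul_le (by exact_mod_cast hε) (EReal.coe_ne_top _), mul_comm]

lemma le_log_scaled_iff {ε : ℝ} (hε : 0 < ε) (m : ℝ≥0∞) (a : ℝ) :
    (a : EReal) ≤ (ε : EReal) * ENNReal.log m ↔ ENNReal.ofReal (Real.exp (a / ε)) ≤ m := by
  rw [← ENNReal.log_le_log_iff (y := m), ENNReal.log_ofReal_of_pos (Real.exp_pos _), Real.log_exp,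
    EReal.coe_div, EReal.div_le_iff_le_mul (by exact_mod_cast hε) (EReal.coe_ne_top _)]

/-- The limit of `-ε log (m ε)`, from exponential bounds on `m`. -/
lemma tendsto_neg_mul_log {m : ℝ → ℝ≥0∞} {L : EReal}
    (hu : ∀ r : ℝ, (r : EReal) < L → ∀ᶠ ε in 𝓝[>] (0 : ℝ), m ε ≤ ENNReal.ofReal (Real.exp (-r / ε)))
    (hl : ∀ r : ℝ, L < r → ∀ᶠ ε in 𝓝[>] (0 : ℝ), ENNReal.ofReal (Real.exp (-r / ε)) ≤ m ε) :
    Tendsto (fun ε : ℝ => -(ε : EReal) * ENNReal.log (m ε)) (𝓝[>] 0) (𝓝 L) := by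
  refine tendsto_order.2 ⟨fun a ha => ?_, fun a ha => ?_⟩
  · obtain ⟨r, har, hrL⟩ := EReal.lt_iff_exists_real_btwn.1 ha
    filter_upwards [hu r hrL, self_mem_nhdsWithin] with ε h hε
    refine har.trans_le ?_
    rw [EReal.neg_mul, EReal.le_neg]
    exact_mod_cast (log_scaled_le_iff hε _ _).2 h
  · obtain ⟨r, hLr, hra⟩ := EReal.lt_iff_exists_real_btwn.1 ha
    filter_upwards [hl r hLr, self_mem_nhdsWithin] with ε h hε
    refine lt_of_le_of_lt ?_ hra
    rw [EReal.neg_mul, EReal.neg_le]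
    exact_mod_cast (le_log_scaled_iff hε _ _).2 h

lemma eventually_le_exp_div (c : ℝ) {δ : ℝ} (hδ : 0 < δ) :
    ∀ᶠ ε in 𝓝[>] (0 : ℝ), c ≤ Real.exp (δ / ε) := by
  have h : Tendsto (fun ε : ℝ => Real.exp (δ / ε)) (𝓝[>] 0) atTop := by
    simp_rw [div_eq_mul_inv]
    exact Real.tendsto_exp_atTop.comp (tendsto_inv_nhdsGT_zero.const_mul_atTop hδ)
  exact h.eventually_ge_atTop c

end ExponentialScale

/-! ### Consequences of the large deviation principle -/

section LDP

variable {S : Type*} [TopologicalSpace S] [MeasurableSpace S] {ν : ℝ → Measure S} {I : S → ℝ≥0∞}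

lemma SatisfiesLDP.eventually_le (h : SatisfiesLDP ν I) {C : Set S} (hC : IsClosed C) {a b : ℝ}
    (hI : ∀ x ∈ C, (a : EReal) ≤ (I x : EReal)) (hb : b < a) :
    ∀ᶠ ε in 𝓝[>] (0 : ℝ), ν ε C ≤ ENNReal.ofReal (Real.exp (-b / ε)) := by
  have h1 : limsup (fun ε : ℝ => (ε : EReal) * ENNReal.log (ν ε C)) (𝓝[>] 0) < ((-b : ℝ) : EReal) := by
    refine (h.upper C hC).trans_lt (lt_of_le_of_lt (EReal.neg_le_neg_iff.2 (le_iInf₂ hI)) ?_)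
    exact_mod_cast neg_lt_neg hb
  filter_upwards [eventually_lt_of_limsup_lt h1, self_mem_nhdsWithin] with ε h2 hε
  exact (log_scaled_le_iff hε _ _).1 h2.le

lemma SatisfiesLDP.eventually_ge (h : SatisfiesLDP ν I) {U : Set S} (hU : IsOpen U) {x : S}
    (hx : x ∈ U) (hIx : I x ≠ ∞) {b : ℝ} (hb : (I x).toReal < b) :
    ∀ᶠ ε in 𝓝[>] (0 : ℝ), ENNReal.ofReal (Real.exp (-b / ε)) ≤ ν ε U := by
  have h1 : ((-b : ℝ) : EReal) < liminf (fun ε : ℝ => (ε : EReal) * ENNReal.log (ν ε U)) (𝓝[>] 0) := by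
    refine lt_of_lt_of_le ?_ ((EReal.neg_le_neg_iff.2 (iInf₂_le x hx)).trans (h.lower U hU))
    rw [EReal.coe_neg, EReal.neg_lt_neg_iff, ← EReal.coe_toReal (x := (I x : EReal)) (by simpa) (by simp)]
    simpa using hb
  filter_upwards [eventually_lt_of_lt_liminf h1, self_mem_nhdsWithin] with ε h2 hε
  exact (le_log_scaled_iff hε _ _).1 h2.le

lemma IsRateFunction.isClosed_le {S : Type*} [TopologicalSpace S] [T2Space S] {I : S → ℝ≥0∞}
    (h : IsRateFunction I) (a : ℝ≥0∞) :
    IsClosed {x | I x ≤ a} := by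
  induction a with
  | top => simp
  | coe a => exact (h a).isClosed

lemma IsRateFunction.lowerSemicontinuous {S : Type*} [TopologicalSpace S] [T2Space S]
    {I : S → ℝ≥0∞} (h : IsRateFunction I) :
    LowerSemicontinuous I :=
  lowerSemicontinuous_iff_isClosed_preimage.2 fun a => h.isClosed_le a

/-- The upper bound on the whole space, which has mass 1, forces inf I = 0. Lower semicontinuity on
the compact set {I ≤ 1} makes the infimum attained. -/
lemma SatisfiesLDP.exists_eq_zero [T2Space S] (h : SatisfiesLDP ν I)
    (hν : ∀ ε, 0 < ε → IsProbabilityMeasure (ν ε)) : ∃ x, I x = 0 := by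
  have key : ∀ a : ℝ, 0 < a → ∃ x, I x < ENNReal.ofReal a := by
    intro a ha
    by_contra! hcon
    have h1 := h.eventually_le (C := Set.univ) isClosed_univ (a := a) (b := a / 2)
      (fun x _ => by
        have h2 := EReal.coe_ennreal_le_coe_ennreal_iff.2 (hcon x)
        rwa [EReal.coe_ennreal_ofReal, max_eq_left ha.le] at h2) (by linarith)
    obtain ⟨ε, h2, hε⟩ := (h1.and self_mem_nhdsWithin).exists
    have := hν ε hε
    rw [measure_univ, ENNReal.one_le_ofReal, Real.one_le_exp_iff] at h2
    have : 0 < a / 2 / ε := div_pos (by linarith) hε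
    rw [neg_div] at h2
    linarith
  obtain ⟨z, -⟩ := key 1 one_pos
  by_contra! hne
  have hcpt : IsCompact {x | I x ≤ 1} := by simpa using h.rate 1
  obtain ⟨x, hx⟩ := key 1 one_pos
  obtain ⟨y, hy, hmin⟩ := LowerSemicontinuousOn.exists_isMinOn (s := {x | I x ≤ 1}) (f := I)
    ⟨x, by simpa using hx.le⟩ hcpt (h.rate.lowerSemicontinuous.lowerSemicontinuousOn _)
  have hyt : I y ≠ ∞ := ne_top_of_le_ne_top ENNReal.one_ne_top hy
  obtain ⟨w, hw⟩ := key (I y).toReal (ENNReal.toReal_pos (hne y) hyt)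
  rw [ENNReal.ofReal_toReal hyt] at hw
  exact absurd (hmin (show I w ≤ 1 from hw.le.trans hy)) (not_le.2 hw)

/-- Around a point of finite rate, the rate function is at most `δ` away from its value, as far as
it is finite; where it is infinite, the lower bound holds. -/
lemma IsRateFunction.eventually_near {S : Type*} [TopologicalSpace S] [T2Space S] {I : S → ℝ≥0∞}
    (h : IsRateFunction I)
    (hI : ContinuousOn I {x | I x ≠ ∞}) {y : S} (hy : I y ≠ ∞) {δ : ℝ} (hδ : 0 < δ) :
    ∀ᶠ x in 𝓝 y, (((I y).toReal - δ : ℝ) : EReal) ≤ (I x : EReal) ∧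
      (I x ≠ ∞ → |(I x).toReal - (I y).toReal| ≤ δ) := by
  have h1 : ∀ᶠ x in 𝓝 y, (((I y).toReal - δ : ℝ) : EReal) ≤ (I x : EReal) := by
    rcases lt_or_ge ((I y).toReal - δ) 0 with h0 | h0
    · refine Eventually.of_forall fun x => le_trans ?_ (EReal.coe_ennreal_nonneg _)
      exact_mod_cast h0.le
    · have : ENNReal.ofReal ((I y).toReal - δ) < I y := by
        rw [ENNReal.ofReal_lt_iff_lt_toReal h0 hy]; linarith
      filter_upwards [h.lowerSemicontinuous y _ this] with x hx
      have h2 := EReal.coe_ennreal_le_coe_ennreal_iff.2 hx.le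
      rwa [EReal.coe_ennreal_ofReal, max_eq_left h0] at h2
  have h2 : ContinuousWithinAt (fun x => (I x).toReal) {x | I x ≠ ∞} y :=
    (ENNReal.tendsto_toReal hy).comp (hI y hy)
  have h3 := eventually_nhdsWithin_iff.1 (h2.eventually (Metric.closedBall_mem_nhds _ hδ))
  filter_upwards [h1, h3] with x hx hx' using ⟨hx, hx'⟩

end LDP

/-! ### The cost function: rearrangement, layers and truncation -/

section Cost

variable {K : ℕ} {α : Fin K → ℝ}

/-- The minimal value of `∑ j, α j * v (σ j)` over the permutations `σ`. -/
def minCost (α v : Fin K → ℝ) : ℝ :=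
  Finset.univ.inf' Finset.univ_nonempty (fun σ : Equiv.Perm (Fin K) => ∑ j, α j * v (σ j))

/-- The function `2 ∑ j, α j * v j - min_σ ∑ j, α j * v (σ j)`. -/
def cost (α v : Fin K → ℝ) : ℝ := 2 * ∑ j, α j * v j - minCost α v

lemma minCost_le (α v : Fin K → ℝ) (σ : Equiv.Perm (Fin K)) :
    minCost α v ≤ ∑ j, α j * v (σ j) :=
  Finset.inf'_le _ (Finset.mem_univ σ)

/-- Rearrangement inequality: pairing the decreasing `α` with increasing values minimises the sum.
-/
lemma minCost_eq_of_monotone (hα : Antitone α) {v : Fin K → ℝ} {σ : Equiv.Perm (Fin K)}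
    (hσ : Monotone fun j => v (σ j)) : minCost α v = ∑ j, α j * v (σ j) := by
  refine le_antisymm (minCost_le α v σ) (Finset.le_inf' _ _ fun τ _ => ?_)
  have h := (hα.antivary hσ).sum_mul_le_sum_mul_comp_perm (σ := σ⁻¹ * τ)
  simpa using h

lemma cost_nonneg (hα : ∀ j, 0 ≤ α j) {v : Fin K → ℝ} (hv : ∀ j, 0 ≤ v j) : 0 ≤ cost α v := by
  have h := minCost_le α v 1
  have h' : 0 ≤ ∑ j, α j * v j := Finset.sum_nonneg fun j _ => mul_nonneg (hα j) (hv j)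
  simp only [Equiv.Perm.coe_one, id] at h
  unfold cost
  linarith

lemma cost_smul (hα : Antitone α) {s : ℝ} (hs : 0 ≤ s) (v : Fin K → ℝ) :
    cost α (fun j => s * v j) = s * cost α v := by
  have h1 : Monotone fun j => v (Tuple.sort v j) := Tuple.monotone_sort v
  have h2 : Monotone fun j => s * v (Tuple.sort v j) := fun i j hij =>
    mul_le_mul_of_nonneg_left (h1 hij) hs
  have h3 : ∀ σ : Equiv.Perm (Fin K), ∑ j, α j * (s * v (σ j)) = s * ∑ j, α j * v (σ j) :=
    fun σ => by
      rw [Finset.mul_sum]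
      exact Finset.sum_congr rfl fun j _ => by ring
  have h4 := h3 1
  simp only [Equiv.Perm.coe_one, id] at h4
  rw [cost, cost, minCost_eq_of_monotone hα h1,
    minCost_eq_of_monotone (v := fun j => s * v j) hα h2, h3, h4]
  ring

/-- The cost is additive along the decomposition of a vector at the height `s`. -/
lemma cost_eq_add (hα : Antitone α) (s : ℝ) (v : Fin K → ℝ) :
    cost α v = cost α (fun j => min (v j) s) + cost α (fun j => max (v j - s) 0) := by
  -- Both pieces are nondecreasing functions of the entries of `v`, so the permutation sorting `v`
  -- sorts them too, and all three minima are attained at it.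
  have h1 : Monotone fun j => v (Tuple.sort v j) := Tuple.monotone_sort v
  have h2 : Monotone fun j => min (v (Tuple.sort v j)) s := fun i j hij =>
    min_le_min_right _ (h1 hij)
  have h3 : Monotone fun j => max (v (Tuple.sort v j) - s) 0 := fun i j hij =>
    max_le_max_right _ (sub_le_sub_right (h1 hij) _)
  have h4 : ∀ t : ℝ, min t s + max (t - s) 0 = t := fun t => by
    rcases le_total t s with h | h
    · rw [min_eq_left h, max_eq_right (by linarith)]; ring
    · rw [min_eq_right h, max_eq_left (by linarith)]; ring
  have h5 : ∀ σ : Equiv.Perm (Fin K), ∑ j, α j * v (σ j)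
      = ∑ j, α j * min (v (σ j)) s + ∑ j, α j * max (v (σ j) - s) 0 := fun σ => by
    rw [← Finset.sum_add_distrib]
    exact Finset.sum_congr rfl fun j _ => by rw [← mul_add, h4]
  have h6 := h5 1
  simp only [Equiv.Perm.coe_one, id] at h6
  rw [cost, cost, cost, minCost_eq_of_monotone hα h1,
    minCost_eq_of_monotone (v := fun j => min (v j) s) hα h2,
    minCost_eq_of_monotone (v := fun j => max (v j - s) 0) hα h3, h5 (Tuple.sort v), h6]
  ring

/-- The excess above `s` is a nonnegative vector, so the part split off by `cost_eq_add` has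
nonnegative cost. -/
lemma cost_min_le (hα : Antitone α) (hα0 : ∀ j, 0 ≤ α j) (s : ℝ) (v : Fin K → ℝ) :
    cost α (fun j => min (v j) s) ≤ cost α v := by
  rw [cost_eq_add hα s v]
  have := cost_nonneg (v := fun j => max (v j - s) 0) hα0 fun j => le_max_right _ _
  linarith

/-- The cost of a nonnegative vector is at least that of a vector which takes only one value
besides `0`, with the same entry at `i`. -/
lemma exists_mul_cost_indicator_le (hα : Antitone α) (hα0 : ∀ j, 0 ≤ α j) (i : Fin K)
    {v : Fin K → ℝ} (hv : ∀ j, 0 ≤ v j) :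
    ∃ B : Finset (Fin K), i ∈ B ∧ v i * cost α (fun j => if j ∈ B then 1 else 0) ≤ cost α v := by
  induction hn : (Finset.univ.filter fun j => 0 < v j).card using Nat.strong_induction_on
    generalizing v with
  | _ n ih =>
  subst hn
  rcases (hv i).eq_or_lt with h0 | h0
  · exact ⟨Finset.univ, Finset.mem_univ i, by rw [← h0, zero_mul]; exact cost_nonneg hα0 hv⟩
  set B := Finset.univ.filter fun j => 0 < v j with hB
  have hiB : i ∈ B := by simp [hB, h0]
  -- The lowest layer is peeled off: `v` is `v k` times the indicator of its support `B` plus a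
  -- remainder `w`, which vanishes at `k` and so has smaller support.
  obtain ⟨k, hkB, hk⟩ := B.exists_min_image v ⟨i, hiB⟩
  have hk0 : 0 < v k := by simpa [hB] using hkB
  have h1 : (fun j => min (v j) (v k)) = fun j => v k * if j ∈ B then 1 else 0 := by
    funext j
    by_cases hj : j ∈ B
    · simp [hj, hk j hj]
    · have : v j = 0 := le_antisymm (by simpa [hB] using hj) (hv j)
      simp [hj, this, hk0.le]
  set w : Fin K → ℝ := fun j => max (v j - v k) 0 with hw
  have hwi : w i = v i - v k := max_eq_left (sub_nonneg.2 (hk i hiB))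
  have hlt : (Finset.univ.filter fun j => 0 < w j).card < B.card := by
    refine Finset.card_lt_card ((Finset.ssubset_iff_of_subset fun j hj => ?_).2 ⟨k, hkB, ?_⟩)
    · simp only [hw, hB, Finset.mem_filter, Finset.mem_univ, true_and, lt_max_iff, lt_irrefl,
        or_false] at hj ⊢
      linarith
    · simp [hw]
  obtain ⟨B', hiB', hB'⟩ := ih _ hlt (v := w) (fun j => le_max_right _ _) rfl
  have h2 := cost_eq_add hα (v k) v
  rw [h1, cost_smul hα hk0.le] at h2
  rw [hwi] at hB'
  have h3 := hk i hiB
  -- The cost of `v` is at least `v k` times that of `B` plus `v i - v k` times that of `B'`. The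
  -- coefficients add up to `v i`, so the cheaper of the two sets works.
  rcases le_total (cost α fun j => if j ∈ B then 1 else 0)
    (cost α fun j => if j ∈ B' then 1 else 0) with h | h
  · refine ⟨B, hiB, ?_⟩
    have := mul_le_mul_of_nonneg_left h (sub_nonneg.2 h3)
    linarith
  · refine ⟨B', hiB', ?_⟩
    have := mul_le_mul_of_nonneg_left h hk0.le
    linarith

/-- If `v` is maximal off an initial segment, it can be sorted by a permutation of that segment. -/
lemma exists_perm_monotone {p : Fin K → Prop} [DecidablePred p]
    (hp : ∀ i j, i ≤ j → p j → p i) {v : Fin K → ℝ} (hv : ∀ j, ¬ p j → ∀ i, v i ≤ v j) :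
    ∃ τ : Equiv.Perm (Fin K), (∀ j, ¬ p j → τ j = j) ∧ (∀ j, p j → p (τ j)) ∧
      Monotone fun j => v (τ j) := by
  let e : Fin (Fintype.card {j // p j}) ≃o {j // p j} := Fintype.orderIsoFinOfCardEq _ rfl
  let s := Tuple.sort fun i => v (e i)
  let τ₀ : Equiv.Perm {j // p j} := e.symm.toEquiv.trans (s.trans e.toEquiv)
  have hs : Monotone fun i => v (e (s i)) := Tuple.monotone_sort fun i => v (e i)
  have hτ : ∀ j (hj : p j), Equiv.Perm.ofSubtype τ₀ j = e (s (e.symm ⟨j, hj⟩)) := fun j hj => by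
    rw [Equiv.Perm.ofSubtype_apply_of_mem _ hj]; rfl
  have hτ' : ∀ j, ¬ p j → Equiv.Perm.ofSubtype τ₀ j = j := fun j hj =>
    Equiv.Perm.ofSubtype_apply_of_not_mem _ hj
  refine ⟨Equiv.Perm.ofSubtype τ₀, hτ', fun j hj => ?_, fun i j hij => ?_⟩
  · rw [hτ j hj]; exact (e _).2
  · by_cases hj : p j
    · have hi := hp i j hij hj
      simp only [hτ j hj, hτ i hi]
      exact hs (e.symm.monotone (by exact hij))
    · simp only [hτ' j hj]
      exact hv j hj _

/-- For a vector given on the coordinates with `0 < α j`, permutations of these coordinates reach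
the minimal cost; the value of the other coordinates does not matter. -/
lemma exists_perm_cost (hα : Antitone α) (hα0 : ∀ j, 0 ≤ α j) (i₀ : Fin K) (hi₀ : 0 < α i₀)
    {v : Fin K → ℝ} (hv : ∀ j, 0 ≤ v j) :
    ∃ (τ : Equiv.Perm (Fin K)) (w : Fin K → ℝ), (∀ j, ¬ 0 < α j → τ j = j) ∧
      (∀ j, 0 < α j → 0 < α (τ j)) ∧ (∀ j, 0 ≤ w j ∧ w j ≤ w i₀) ∧ w i₀ = v i₀ ∧
      cost α w ≤ 2 * ∑ j, α j * v j - ∑ j, α j * v (τ j) := by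
  classical
  set R := ∑ j, v j
  have hR : ∀ j, v j ≤ R := fun j =>
    Finset.single_le_sum (f := v) (fun j _ => hv j) (Finset.mem_univ j)
  -- Coordinates with `α j = 0` have no weight in the sum, so they may take the value `R`, at least
  -- as large as every entry. Being last and largest, they are already in sorted position.
  set u : Fin K → ℝ := fun j => if 0 < α j then v j else R with hu
  have hu0 : ∀ j, 0 ≤ u j := fun j => by
    simp only [hu]; split_ifs; exacts [hv j, (hv j).trans (hR j)]
  obtain ⟨τ, h1, h2, h3⟩ := exists_perm_monotone (p := fun j => 0 < α j) (v := u)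
    (fun i j hij hj => hj.trans_le (hα hij)) (fun j hj i => by
      simp only [hu, if_neg hj]; split_ifs; exacts [hR i, le_rfl])
  have hz : ∀ j, ¬ 0 < α j → α j = 0 := fun j hj => le_antisymm (not_lt.1 hj) (hα0 j)
  -- Truncation at `u i₀` enforces `w j ≤ w i₀` without raising the cost.
  refine ⟨τ, fun j => min (u j) (u i₀), h1, h2, fun j => ⟨le_min (hu0 j) (hu0 _), ?_⟩, ?_, ?_⟩
  · simp
  · simp [hu, hi₀]
  · refine (cost_min_le hα hα0 _ u).trans (le_of_eq ?_)
    rw [cost, minCost_eq_of_monotone hα h3]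
    congr 1
    · congr 1
      refine Finset.sum_congr rfl fun j _ => ?_
      by_cases hj : 0 < α j
      · simp [hu, hj]
      · simp [hz j hj]
    · refine Finset.sum_congr rfl fun j _ => ?_
      by_cases hj : 0 < α j
      · simp [hu, h2 j hj]
      · simp [hz j hj]

lemma V_le [NeZero K] {S : Type*} {I : S → ℝ≥0∞} {F : S → ℝ} {w : Fin K → ℝ}
    (hw : ∀ j, 0 ≤ w j ∧ w j ≤ w 0) {x : S} (hx : I x ≠ ∞) (hx' : (I x).toReal = w 0) :
    V I F α ≤ ((cost α w + 2 * F x : ℝ) : EReal) := by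
  have hmem : (((w 0).toNNReal : ℝ≥0∞), F x) ∈ Set.range fun x => (I x, F x) := by
    refine ⟨x, Prod.ext ?_ rfl⟩
    change I x = ENNReal.ofReal (w 0)
    rw [← hx', ENNReal.ofReal_toReal hx]
  refine (iInf₂_le (fun j => (w j).toNNReal) (F x)).trans ?_
  refine (iInf₂_le hmem fun j => Real.toNNReal_le_toNNReal (hw j).2).trans (le_of_eq ?_)
  have h : ∀ j, ((w j).toNNReal : ℝ) = w j := fun j => Real.coe_toNNReal _ (hw j).1
  simp only [h, cost, minCost]
  congr 1
  ring

/-- The values admitted in `V` may not be values of `I`. The layer argument replaces them by entries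
0 and `I x`, which actual points realise. -/
lemma exists_cost_lt_of_V_lt [NeZero K] (hα : Antitone α) (hα0 : ∀ j, 0 ≤ α j) {S : Type*}
    {I : S → ℝ≥0∞} {F : S → ℝ} {r : ℝ} (hr : V I F α < r) :
    ∃ (x : S) (B : Finset (Fin K)), I x ≠ ∞ ∧ 0 ∈ B ∧
      cost α (fun j => if j ∈ B then (I x).toReal else 0) + 2 * F x < r := by
  simp only [V, iInf_lt_iff] at hr
  obtain ⟨v, f, ⟨x, hx⟩, -, hr⟩ := hr
  obtain ⟨hIx, rfl⟩ := Prod.ext_iff.1 hx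
  simp only at hIx hr
  obtain ⟨B, hB, h⟩ := exists_mul_cost_indicator_le hα hα0 0 (v := fun j => (v j : ℝ))
    fun j => NNReal.coe_nonneg _
  refine ⟨x, B, by simp [hIx], hB, ?_⟩
  have h1 : (fun j => if j ∈ B then (I x).toReal else 0)
      = fun j => (v 0 : ℝ) * if j ∈ B then 1 else 0 := by
    funext j; simp [hIx]
  rw [h1, cost_smul hα (NNReal.coe_nonneg _)]
  have h2 := EReal.coe_lt_coe_iff.1 hr
  simp only [cost, minCost] at h h2 ⊢
  linarith

end Cost

/-! ### Densities of product measures and permutation invariance -/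

section ProductDensity

variable {S : Type*} [MeasurableSpace S] {γ : Measure S} [SigmaFinite γ]

lemma lintegral_pi_prod {n : ℕ} {f : Fin n → S → ℝ≥0∞} (hf : ∀ i, Measurable (f i)) :
    ∫⁻ x, ∏ i, f i (x i) ∂(Measure.pi fun _ : Fin n => γ) = ∏ i, ∫⁻ x, f i x ∂γ := by
  induction n with
  | zero => simp
  | succ n ih =>
    have hm := (measurePreserving_piFinSuccAbove (fun _ : Fin (n + 1) => γ) 0).symm
    rw [← hm.lintegral_comp (by fun_prop)]
    simp only [MeasurableEquiv.piFinSuccAbove_symm_apply, Fin.insertNthEquiv, Equiv.coe_fn_mk,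
      Fin.insertNth_zero', Fin.prod_univ_succ, Fin.cons_zero, Fin.cons_succ]
    rw [lintegral_prod_mul (g := fun x : Fin n → S => ∏ i, f i.succ (x i)) (hf 0).aemeasurable
      (Finset.measurable_fun_prod _ fun i _ => (hf i.succ).comp (measurable_pi_apply i)).aemeasurable,
      ih fun i => hf i.succ]

lemma pi_withDensity {n : ℕ} {f : Fin n → S → ℝ≥0∞} (hf : ∀ i, Measurable (f i))
    [∀ i, SigmaFinite (γ.withDensity (f i))] :
    Measure.pi (fun i => γ.withDensity (f i))
      = (Measure.pi fun _ : Fin n => γ).withDensity fun x => ∏ i, f i (x i) := by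
  refine Measure.pi_eq fun s hs => ?_
  rw [withDensity_apply _ (MeasurableSet.univ_pi hs), ← lintegral_indicator (MeasurableSet.univ_pi hs)]
  have h : ((Set.univ.pi s).indicator fun x : Fin n → S => ∏ i, f i (x i))
      = fun x => ∏ i, (s i).indicator (f i) (x i) := by
    funext x
    by_cases hx : x ∈ Set.univ.pi s
    · rw [Set.indicator_of_mem hx]
      exact Finset.prod_congr rfl fun i _ => (Set.indicator_of_mem (hx i trivial) _).symm
    · rw [Set.indicator_of_notMem hx]
      obtain ⟨i, hi⟩ : ∃ i, x i ∉ s i := by simpa [Set.mem_pi] using hx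
      exact (Finset.prod_eq_zero (Finset.mem_univ i) (Set.indicator_of_notMem hi _)).symm
  rw [h, lintegral_pi_prod fun i => (hf i).indicator (hs i)]
  exact Finset.prod_congr rfl fun i _ => by
    rw [lintegral_indicator (hs i), withDensity_apply _ (hs i)]

lemma lintegral_pi_comp_perm {n : ℕ} (σ : Equiv.Perm (Fin n)) {f : (Fin n → S) → ℝ≥0∞}
    (hf : Measurable f) :
    ∫⁻ x, f (fun j => x (σ j)) ∂(Measure.pi fun _ : Fin n => γ)
      = ∫⁻ x, f x ∂(Measure.pi fun _ : Fin n => γ) := by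
  have h := measurePreserving_piCongrLeft (fun _ : Fin n => γ) σ.symm
  rw [← h.lintegral_comp hf]
  refine lintegral_congr fun x => ?_
  congr 1
  funext j
  have := MeasurableEquiv.piCongrLeft_apply_apply (β := fun _ : Fin n => S) σ.symm x (σ j)
  simpa using this.symm

end ProductDensity

/-! ### Symmetrized weights and the symmetrization identity -/

section SymWeight

variable {S : Type*} {K : ℕ} {w : (Fin K → S) → ℝ}

lemma sum_perm_comp (w : (Fin K → S) → ℝ) (x : Fin K → S) (σ : Equiv.Perm (Fin K)) :
    ∑ τ : Equiv.Perm (Fin K), w (fun j => x (σ (τ j)))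
      = ∑ τ : Equiv.Perm (Fin K), w (fun j => x (τ j)) :=
  Fintype.sum_equiv (Equiv.mulLeft σ) _ _ fun _ => rfl

lemma symWeight_nonneg (hw : ∀ x, 0 ≤ w x) (x : Fin K → S) : 0 ≤ symWeight w x :=
  div_nonneg (hw x) (Finset.sum_nonneg fun _ _ => hw _)

lemma le_sum_perm (hw : ∀ x, 0 ≤ w x) (x : Fin K → S) (τ : Equiv.Perm (Fin K)) :
    w (fun j => x (τ j)) ≤ ∑ τ : Equiv.Perm (Fin K), w (fun j => x (τ j)) :=
  Finset.single_le_sum (f := fun τ : Equiv.Perm (Fin K) => w (fun j => x (τ j)))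
    (fun _ _ => hw _) (Finset.mem_univ τ)

lemma symWeight_le_one (hw : ∀ x, 0 ≤ w x) (x : Fin K → S) : symWeight w x ≤ 1 :=
  div_le_one_of_le₀ (le_sum_perm hw x 1) (Finset.sum_nonneg fun _ _ => hw _)

lemma symWeight_eq_zero_iff (hw : ∀ x, 0 ≤ w x) (x : Fin K → S) : symWeight w x = 0 ↔ w x = 0 := by
  refine ⟨fun h => ?_, fun h => by simp [symWeight, h]⟩
  rcases div_eq_zero_iff.1 h with h | h
  · exact h
  · exact le_antisymm (h ▸ le_sum_perm hw x 1) (hw x)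

/-- This survives a vanishing denominator, because `w x` is one of its nonnegative terms and so
vanishes too. -/
lemma symWeight_mul_sum (hw : ∀ x, 0 ≤ w x) (x : Fin K → S) :
    symWeight w x * ∑ τ : Equiv.Perm (Fin K), w (fun j => x (τ j)) = w x := by
  by_cases h : ∑ τ : Equiv.Perm (Fin K), w (fun j => x (τ j)) = 0
  · rw [h, mul_zero]
    exact le_antisymm (hw x) (h ▸ le_sum_perm hw x 1)
  · exact div_mul_cancel₀ _ h

/-- Quotients of symmetrized weights are quotients of weights. -/
lemma symWeight_div_perm (hw : ∀ x, 0 ≤ w x) {x : Fin K → S} (hx : w x ≠ 0)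
    (τ : Equiv.Perm (Fin K)) :
    symWeight w x / symWeight w (fun j => x (τ j)) = w x / w (fun j => x (τ j)) := by
  have h : 0 < ∑ τ : Equiv.Perm (Fin K), w (fun j => x (τ j)) :=
    ((hw x).lt_of_ne' hx).trans_le (le_sum_perm hw x 1)
  rw [symWeight, symWeight, sum_perm_comp, div_div_div_cancel_right₀ h.ne']

lemma symWeight_le_div (hw : ∀ x, 0 ≤ w x) (x : Fin K → S) (τ : Equiv.Perm (Fin K))
    (hτ : w (fun j => x (τ j)) ≠ 0) : symWeight w x ≤ w x / w (fun j => x (τ j)) :=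
  div_le_div_of_nonneg_left (hw x) ((hw _).lt_of_ne' hτ) (le_sum_perm hw x τ)

variable [MeasurableSpace S]

lemma measurable_symWeight (hw : Measurable w) : Measurable (symWeight w) := by
  unfold symWeight
  fun_prop

variable {γ : Measure S} [SigmaFinite γ] [NeZero K]

/-- Symmetrization of the second moment. -/
lemma lintegral_sum_symWeight_sq {h : Fin K → S → ℝ≥0} (hh : ∀ j, Measurable (h j))
    [∀ j, SigmaFinite (γ.withDensity fun x => (h j x : ℝ≥0∞))] {e : S → ℝ} (he : Measurable e) :
    ∑ σ : Equiv.Perm (Fin K), ∫⁻ x, ENNReal.ofReal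
        ((symWeight (fun x => ∏ j, (h j (x j) : ℝ)) (fun j => x (σ j)) * e (x (σ 0))) ^ 2)
        ∂(Measure.pi fun j => γ.withDensity fun x => (h j x : ℝ≥0∞))
      = ∫⁻ x, ENNReal.ofReal (symWeight (fun x => ∏ j, (h j (x j) : ℝ)) x * e (x 0) ^ 2)
        ∂(Measure.pi fun j => γ.withDensity fun x => (h j x : ℝ≥0∞)) := by
  set w : (Fin K → S) → ℝ := fun x => ∏ j, (h j (x j) : ℝ) with hwdef
  have hw : ∀ x, 0 ≤ w x := fun x => Finset.prod_nonneg fun _ _ => NNReal.coe_nonneg _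
  have hwm : Measurable w := by fun_prop
  have hsm := measurable_symWeight hwm
  have hden : (fun x : Fin K → S => ∏ j, (h j (x j) : ℝ≥0∞)) = fun x => ENNReal.ofReal (w x) := by
    funext x
    rw [hwdef, ENNReal.ofReal_prod_of_nonneg fun _ _ => NNReal.coe_nonneg _]
    simp
  have hwm' : Measurable fun x => ENNReal.ofReal (w x) := by fun_prop
  rw [pi_withDensity fun j => by fun_prop, hden]
  have hm : ∀ σ : Equiv.Perm (Fin K), Measurable fun x : Fin K → S =>
      ENNReal.ofReal ((symWeight w (fun j => x (σ j)) * e (x (σ 0))) ^ 2) := fun σ => by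
    have : Measurable fun x : Fin K → S => symWeight w (fun j => x (σ j)) :=
      hsm.comp (by fun_prop)
    fun_prop
  have hm1 : Measurable fun x : Fin K → S => ENNReal.ofReal ((symWeight w x * e (x 0)) ^ 2) := by
    fun_prop
  have hw2 : ∀ σ : Equiv.Perm (Fin K), Measurable fun x : Fin K → S =>
      ENNReal.ofReal (w (fun j => x (σ⁻¹ j))) := fun σ => hwm'.comp (by fun_prop)
  have hG : ∀ σ : Equiv.Perm (Fin K), Measurable fun x : Fin K → S =>
      ENNReal.ofReal ((symWeight w x * e (x 0)) ^ 2) * ENNReal.ofReal (w (fun j => x (σ⁻¹ j))) :=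
    fun σ => hm1.mul (hw2 σ)
  -- The reference product measure is permutation invariant, so in each term the permutation moves
  -- from the squared factor onto the density, as its inverse.
  calc _ = ∑ σ : Equiv.Perm (Fin K), ∫⁻ x, ENNReal.ofReal ((symWeight w x * e (x 0)) ^ 2)
        * ENNReal.ofReal (w (fun j => x (σ⁻¹ j))) ∂(Measure.pi fun _ : Fin K => γ) := by
        refine Finset.sum_congr rfl fun σ _ => ?_
        rw [lintegral_withDensity_eq_lintegral_mul _ hwm' (hm σ), ← lintegral_pi_comp_perm σ
          (hG σ)]
        refine lintegral_congr fun x => ?_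
        simp [mul_comm]
    _ = _ := by
        rw [← lintegral_finsetSum _ fun σ _ => hG σ,
          lintegral_withDensity_eq_lintegral_mul _ hwm' (by fun_prop)]
        refine lintegral_congr fun x => ?_
        simp only [Pi.mul_apply]
        rw [← Finset.mul_sum, ← ENNReal.ofReal_sum_of_nonneg fun _ _ => hw _,
          ← ENNReal.ofReal_mul (sq_nonneg _), ← ENNReal.ofReal_mul (hw x)]
        congr 1
        -- Summed over `σ`, the permuted densities form the denominator of the weight; with one of
        -- the two factors `symWeight w x` they give back `w x`.
        have h1 := symWeight_mul_sum hw x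
        have h2 : ∑ σ : Equiv.Perm (Fin K), w (fun j => x (σ⁻¹ j))
            = ∑ τ : Equiv.Perm (Fin K), w (fun j => x (τ j)) :=
          Fintype.sum_equiv (Equiv.inv _) _ _ fun _ => rfl
        rw [h2]
        linear_combination (symWeight w x * e (x 0) ^ 2) * h1

end SymWeight

/-! ### Comparison of the second moment with a first moment -/

section SecondMoment

variable {S : Type*} [MeasurableSpace S] {K : ℕ} [NeZero K] {α : Fin K → ℝ} {γ : Measure S}
  [SigmaFinite γ] {μ : ℝ≥0∞ → Measure S} {g : ℝ≥0∞ → S → ℝ≥0} {Fε : ℝ → S → ℝ} {ε : ℝ}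

/-- The first moment `E (ρ̃^ε (X^ε; α) e ^ (-2 F^ε (X_1^ε) / ε))`, to which the second moment of
the estimator is comparable. -/
def weightedMoment (μ : ℝ≥0∞ → Measure S) (g : ℝ≥0∞ → S → ℝ≥0)
    (Fε : ℝ → S → ℝ) (α : Fin K → ℝ) (ε : ℝ) : ℝ≥0∞ :=
  ∫⁻ x, ENNReal.ofReal (rhoTilde g α ε x * Real.exp (-(1 / ε) * Fε ε (x 0)) ^ 2)
    ∂(Measure.pi fun j => μ (temp ε (α j)))

lemma rhoTilde_nonneg {S : Type*} {K : ℕ} (g : ℝ≥0∞ → S → ℝ≥0) (α : Fin K → ℝ) (ε : ℝ) (x : Fin K → S) :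
    0 ≤ rhoTilde g α ε x :=
  symWeight_nonneg (fun _ => Finset.prod_nonneg fun _ _ => NNReal.coe_nonneg _) x

lemma sum_weightedMoment (hμ : ∀ j, IsProbabilityMeasure (μ (temp ε (α j))))
    (hg : ∀ j, Measurable (g (temp ε (α j))))
    (hμg : ∀ j, μ (temp ε (α j)) = γ.withDensity fun x => (g (temp ε (α j)) x : ℝ≥0∞))
    (hF : Measurable (Fε ε)) :
    ∑ σ : Equiv.Perm (Fin K), ∫⁻ x, ENNReal.ofReal
        ((rhoTilde g α ε (fun j => x (σ j)) * Real.exp (-(1 / ε) * Fε ε (x (σ 0)))) ^ 2)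
        ∂(Measure.pi fun j => μ (temp ε (α j))) = weightedMoment μ g Fε α ε := by
  unfold weightedMoment
  have : ∀ j, SigmaFinite (γ.withDensity fun x => (g (temp ε (α j)) x : ℝ≥0∞)) := fun j => by
    rw [← hμg j]; have := hμ j; infer_instance
  simp_rw [hμg]
  exact lintegral_sum_symWeight_sq (e := fun x => Real.exp (-(1 / ε) * Fε ε x)) hg (by fun_prop)

lemma measurable_rhoTilde_comp {K : ℕ} {α : Fin K → ℝ} (hg : ∀ j, Measurable (g (temp ε (α j)))) (σ : Equiv.Perm (Fin K)) :
    Measurable fun x : Fin K → S => rhoTilde g α ε (fun j => x (σ j)) := by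
  have : Measurable (rhoTilde g α ε) := measurable_symWeight (by fun_prop)
  exact this.comp (by fun_prop)

lemma weightedMoment_le_secondMoment (hμ : ∀ j, IsProbabilityMeasure (μ (temp ε (α j))))
    (hg : ∀ j, Measurable (g (temp ε (α j))))
    (hμg : ∀ j, μ (temp ε (α j)) = γ.withDensity fun x => (g (temp ε (α j)) x : ℝ≥0∞))
    (hF : Measurable (Fε ε)) :
    weightedMoment μ g Fε α ε ≤ secondMoment μ g Fε α ε := by
  rw [← sum_weightedMoment hμ hg hμg hF, ← lintegral_finsetSum]
  · refine lintegral_mono fun x => ?_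
    rw [← ENNReal.ofReal_sum_of_nonneg fun _ _ => sq_nonneg _]
    exact ENNReal.ofReal_le_ofReal (Finset.sum_sq_le_sq_sum_of_nonneg fun σ _ =>
      mul_nonneg (rhoTilde_nonneg _ _ _ _) (Real.exp_pos _).le)
  · intro σ _
    have := measurable_rhoTilde_comp hg σ
    fun_prop

lemma secondMoment_le_weightedMoment (hμ : ∀ j, IsProbabilityMeasure (μ (temp ε (α j))))
    (hg : ∀ j, Measurable (g (temp ε (α j))))
    (hμg : ∀ j, μ (temp ε (α j)) = γ.withDensity fun x => (g (temp ε (α j)) x : ℝ≥0∞))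
    (hF : Measurable (Fε ε)) :
    secondMoment μ g Fε α ε ≤ Fintype.card (Equiv.Perm (Fin K)) * weightedMoment μ g Fε α ε := by
  rw [← sum_weightedMoment hμ hg hμg hF, ← lintegral_finsetSum, ← lintegral_const_mul']
  · refine lintegral_mono fun x => ?_
    rw [← ENNReal.ofReal_sum_of_nonneg fun _ _ => sq_nonneg _, ← ENNReal.ofReal_natCast,
      ← ENNReal.ofReal_mul (Nat.cast_nonneg _)]
    exact ENNReal.ofReal_le_ofReal sq_sum_le_card_mul_sum_sq
  · exact ENNReal.natCast_ne_top _
  · intro σ _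
    have := measurable_rhoTilde_comp hg σ
    fun_prop

end SecondMoment

/-! ### Exponential bounds for the weights -/

section ExpWeight

variable {S : Type*} {K : ℕ} {I : S → ℝ≥0∞} {α : Fin K → ℝ} {ε : ℝ}

/-- The unnormalized weight `e ^ (-(1/ε) ∑ j, α_j I (x_j))`. -/
def expWeight (I : S → ℝ≥0∞) (α : Fin K → ℝ) (ε : ℝ) (x : Fin K → S) : ℝ :=
  expNeg (∑ j, ENNReal.ofReal (α j / ε) * I (x j))

/-- The density `∏ j, g^{ε/α_j} (x_j)`. -/
def densWeight (g : ℝ≥0∞ → S → ℝ≥0) (α : Fin K → ℝ) (ε : ℝ) (x : Fin K → S) : ℝ :=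
  ∏ j, (g (temp ε (α j)) (x j) : ℝ)

lemma expWeight_nonneg (I : S → ℝ≥0∞) (α : Fin K → ℝ) (ε : ℝ) (x : Fin K → S) :
    0 ≤ expWeight I α ε x := by
  unfold expWeight expNeg
  split_ifs <;> positivity

lemma densWeight_nonneg (g : ℝ≥0∞ → S → ℝ≥0) (α : Fin K → ℝ) (ε : ℝ) (x : Fin K → S) :
    0 ≤ densWeight g α ε x :=
  Finset.prod_nonneg fun _ _ => NNReal.coe_nonneg _

lemma expWeight_ne_zero_iff (hε : 0 < ε) {x : Fin K → S} :
    expWeight I α ε x ≠ 0 ↔ ∀ j, 0 < α j → I (x j) ≠ ∞ := by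
  have h : expWeight I α ε x ≠ 0 ↔ ∑ j, ENNReal.ofReal (α j / ε) * I (x j) ≠ ∞ := by
    unfold expWeight expNeg
    split_ifs with h <;> simp [h]
  rw [h, ENNReal.sum_ne_top]
  refine ⟨fun h j hj hI => h j (Finset.mem_univ j) ?_, fun h j _ => ?_⟩
  · rw [hI, ENNReal.mul_top (by simpa using div_pos hj hε)]
  · by_cases hj : 0 < α j
    · exact ENNReal.mul_ne_top ENNReal.ofReal_ne_top (h j hj)
    · rw [ENNReal.ofReal_of_nonpos (div_nonpos_of_nonpos_of_nonneg (not_lt.1 hj) hε.le), zero_mul]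
      exact ENNReal.zero_ne_top

lemma expWeight_eq (hε : 0 < ε) (hα : ∀ j, 0 ≤ α j) {x : Fin K → S}
    (hx : ∀ j, 0 < α j → I (x j) ≠ ∞) :
    expWeight I α ε x = Real.exp (-(∑ j, α j * (I (x j)).toReal) / ε) := by
  have h : ∑ j, ENNReal.ofReal (α j / ε) * I (x j) ≠ ∞ := by
    have := (expWeight_ne_zero_iff hε).2 hx
    contrapose! this
    simp [expWeight, expNeg, this]
  rw [expWeight, expNeg, if_neg h, ENNReal.toReal_sum fun j hj => (ENNReal.sum_ne_top.1 h) j hj,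
    neg_div, Finset.sum_div]
  congr 2
  refine Finset.sum_congr rfl fun j _ => ?_
  rw [ENNReal.toReal_mul, ENNReal.toReal_ofReal (div_nonneg (hα j) hε.le)]
  ring

lemma expWeight_le (hε : 0 < ε) (hα : ∀ j, 0 ≤ α j) {x : Fin K → S} {c : Fin K → ℝ}
    (hc : ∀ j, (c j : EReal) ≤ (I (x j) : EReal)) :
    expWeight I α ε x ≤ Real.exp (-(∑ j, α j * c j) / ε) := by
  by_cases h : expWeight I α ε x = 0
  · rw [h]; positivity
  · have hx := (expWeight_ne_zero_iff hε).1 h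
    rw [expWeight_eq hε hα hx]
    refine Real.exp_le_exp.2 (div_le_div_of_nonneg_right (neg_le_neg ?_) hε.le)
    refine Finset.sum_le_sum fun j _ => ?_
    rcases (hα j).eq_or_lt with h0 | h0
    · simp [← h0]
    · refine mul_le_mul_of_nonneg_left ?_ h0.le
      have h1 := hc j
      rw [← EReal.coe_toReal (x := (I (x j) : EReal)) (by simpa using hx j h0) (by simp)] at h1
      simpa using h1

/-- The weights `ρ̃^ε` and `ρ^ε` at `x` vanish together and agree up to a factor
`e ^ (± δ / ε)`. -/
def LogRatioLT (I : S → ℝ≥0∞) (g : ℝ≥0∞ → S → ℝ≥0) (α : Fin K → ℝ) (δ ε : ℝ) (x : Fin K → S) :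
    Prop :=
  (rhoTilde g α ε x = 0 ↔ rho I α ε x = 0) ∧
    |ε * Real.log (rhoTilde g α ε x / rho I α ε x)| < δ

variable {g : ℝ≥0∞ → S → ℝ≥0} {δ : ℝ} {x : Fin K → S}

lemma LogRatioLT.densWeight_eq_zero_iff (h : LogRatioLT I g α δ ε x) :
    densWeight g α ε x = 0 ↔ expWeight I α ε x = 0 := by
  rw [← symWeight_eq_zero_iff (densWeight_nonneg g α ε),
    ← symWeight_eq_zero_iff (expWeight_nonneg I α ε)]
  exact h.1

lemma LogRatioLT.le (h : LogRatioLT I g α δ ε x) (hε : 0 < ε) :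
    rhoTilde g α ε x ≤ Real.exp (δ / ε) * rho I α ε x ∧
      rho I α ε x ≤ Real.exp (δ / ε) * rhoTilde g α ε x := by
  by_cases h0 : rho I α ε x = 0
  · rw [h0, h.1.2 h0]; simp
  have h1 : 0 < rho I α ε x := (symWeight_nonneg (expWeight_nonneg I α ε) x).lt_of_ne' h0
  have h2 : 0 < rhoTilde g α ε x := (symWeight_nonneg (densWeight_nonneg g α ε) x).lt_of_ne'
    fun h2 => h0 (h.1.1 h2)
  obtain ⟨h3, h4⟩ := abs_lt.1 h.2
  have h5 : Real.log (rhoTilde g α ε x) - Real.log (rho I α ε x) < δ / ε := by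
    rwa [← Real.log_div h2.ne' h1.ne', lt_div_iff₀ hε, mul_comm]
  have h6 : Real.log (rho I α ε x) - Real.log (rhoTilde g α ε x) < δ / ε := by
    rw [← neg_sub, ← Real.log_div h2.ne' h1.ne', lt_div_iff₀ hε]
    linarith
  refine ⟨?_, ?_⟩
  · rw [← Real.exp_log h2, ← Real.exp_log h1, ← Real.exp_add]
    exact Real.exp_le_exp.2 (by linarith)
  · rw [← Real.exp_log h2, ← Real.exp_log h1, ← Real.exp_add]
    exact Real.exp_le_exp.2 (by linarith)

/-- Upper bound for `ρ̃^ε` at a point where the density does not vanish; the comparison with `ρ^ε`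
is only needed at points whose coordinates with `α_j = 0` are equal to a fixed zero of `I`. -/
lemma rhoTilde_le (hε : 0 < ε) (hα : ∀ j, 0 ≤ α j) {x₀ : S} (hx₀ : I x₀ = 0)
    {τ : Equiv.Perm (Fin K)} (hτ : ∀ j, ¬ 0 < α j → τ j = j) (hτ' : ∀ j, 0 < α j → 0 < α (τ j))
    {x' : Fin K → S} (hx' : ∀ j, x' j = if 0 < α j then x j else x₀)
    (hx : ∀ j, g (temp ε (α j)) (x j) ≠ 0) (h₀ : LogRatioLT I g α δ ε fun _ => x₀)
    (h₁ : LogRatioLT I g α δ ε x') (h₂ : LogRatioLT I g α δ ε fun j => x' (τ j)) :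
    (∀ j, 0 < α j → I (x j) ≠ ∞) ∧ rhoTilde g α ε x ≤ Real.exp
      ((2 * δ - ∑ j, α j * (I (x j)).toReal + ∑ j, α j * (I (x (τ j))).toReal) / ε) := by
  -- At the constant point `x₀` the weight built from `I` is positive, hence so is every density
  -- factor.
  have hg₀ : ∀ j, g (temp ε (α j)) x₀ ≠ 0 := by
    have h : densWeight g α ε (fun _ => x₀) ≠ 0 := by
      rw [Ne, h₀.densWeight_eq_zero_iff]
      exact (expWeight_ne_zero_iff hε).2 fun j _ => by simp [hx₀]
    intro j hj
    exact h (Finset.prod_eq_zero (Finset.mem_univ j) (by simp [hj]))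
  have hd' : densWeight g α ε x' ≠ 0 := by
    refine Finset.prod_ne_zero_iff.2 fun j _ => ?_
    rw [hx']
    split_ifs
    · exact_mod_cast hx j
    · exact_mod_cast hg₀ j
  have he' : expWeight I α ε x' ≠ 0 := fun h => hd' (h₁.densWeight_eq_zero_iff.2 h)
  have hI' := (expWeight_ne_zero_iff hε).1 he'
  have hI : ∀ j, 0 < α j → I (x j) ≠ ∞ := fun j hj => by simpa [hx', hj] using hI' j hj
  have hIτ : ∀ j, 0 < α j → I (x' (τ j)) ≠ ∞ := fun j hj => hI' _ (hτ' j hj)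
  have heτ : expWeight I α ε (fun j => x' (τ j)) ≠ 0 := (expWeight_ne_zero_iff hε).2 hIτ
  have hdτ : densWeight g α ε (fun j => x' (τ j)) ≠ 0 := fun h =>
    heτ (h₂.densWeight_eq_zero_iff.1 h)
  -- Where `α j = 0`, `τ` fixes `j` and both quotients are 1, so the uncontrolled coordinates drop
  -- out.
  have hfac : ∀ j, (g (temp ε (α j)) (x j) : ℝ) / g (temp ε (α j)) (x (τ j))
      = g (temp ε (α j)) (x' j) / g (temp ε (α j)) (x' (τ j)) := fun j => by
    by_cases hj : 0 < α j
    · rw [hx', hx', if_pos hj, if_pos (hτ' j hj)]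
    · rw [hτ j hj, hx', if_neg hj, div_self (by exact_mod_cast hx j),
        div_self (by exact_mod_cast hg₀ j)]
  have hquot : densWeight g α ε x / densWeight g α ε (fun j => x (τ j))
      = densWeight g α ε x' / densWeight g α ε (fun j => x' (τ j)) := by
    simp only [densWeight, ← Finset.prod_div_distrib, hfac]
  have hne : densWeight g α ε (fun j => x (τ j)) ≠ 0 := fun h => by
    rw [h, div_zero] at hquot
    exact div_ne_zero hd' hdτ hquot.symm
  refine ⟨hI, ?_⟩
  have hsum : ∑ j, α j * (I (x' j)).toReal = ∑ j, α j * (I (x j)).toReal ∧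
      ∑ j, α j * (I (x' (τ j))).toReal = ∑ j, α j * (I (x (τ j))).toReal := by
    constructor <;> refine Finset.sum_congr rfl fun j _ => ?_
    · rcases (hα j).eq_or_lt with h0 | h0
      · simp [← h0]
      · rw [hx', if_pos h0]
    · rcases (hα j).eq_or_lt with h0 | h0
      · simp [← h0]
      · rw [hx', if_pos (hτ' j h0)]
  have hpos : 0 < rhoTilde g α ε (fun j => x' (τ j)) :=
    (symWeight_nonneg (densWeight_nonneg g α ε) _).lt_of_ne'
      fun h => hdτ ((symWeight_eq_zero_iff (densWeight_nonneg g α ε) _).1 h)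
  have hpos' : 0 < rho I α ε (fun j => x' (τ j)) :=
    (symWeight_nonneg (expWeight_nonneg I α ε) _).lt_of_ne'
      fun h => heτ ((symWeight_eq_zero_iff (expWeight_nonneg I α ε) _).1 h)
  -- The denominator of ρ̃ is bounded below by its `τ` term. The resulting quotient of densities is
  -- a quotient of ρ̃'s at `x'`, where passing to ρ costs two factors `exp (δ / ε)`.
  calc rhoTilde g α ε x ≤ densWeight g α ε x / densWeight g α ε (fun j => x (τ j)) :=
        symWeight_le_div (densWeight_nonneg g α ε) x τ hne
    _ = rhoTilde g α ε x' / rhoTilde g α ε (fun j => x' (τ j)) := by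
        rw [hquot]
        exact (symWeight_div_perm (densWeight_nonneg g α ε) hd' τ).symm
    _ ≤ Real.exp (δ / ε) * rho I α ε x' /
        (rho I α ε (fun j => x' (τ j)) / Real.exp (δ / ε)) := by
        refine div_le_div₀ (mul_nonneg (Real.exp_pos _).le
          (symWeight_nonneg (expWeight_nonneg I α ε) _)) (h₁.le hε).1
          (div_pos hpos' (Real.exp_pos _)) ?_
        rw [div_le_iff₀' (Real.exp_pos _)]
        exact (h₂.le hε).2
    _ = Real.exp (δ / ε) * Real.exp (δ / ε) *
        (rho I α ε x' / rho I α ε (fun j => x' (τ j))) := by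
        field_simp
    _ = Real.exp (δ / ε) * Real.exp (δ / ε) *
        (expWeight I α ε x' / expWeight I α ε (fun j => x' (τ j))) := by
        congr 1
        exact symWeight_div_perm (expWeight_nonneg I α ε) he' τ
    _ = _ := by
        rw [expWeight_eq hε hα hI', expWeight_eq hε hα hIτ, hsum.1, hsum.2, ← Real.exp_sub,
          ← Real.exp_add, ← Real.exp_add]
        congr 1
        ring

/-- Lower bound for `ρ^ε`. -/
lemma le_rho (hε : 0 < ε) (hα : ∀ j, 0 ≤ α j) {v : Fin K → ℝ}
    (hx : ∀ j, 0 < α j → I (x j) ≠ ∞) (hl : ∀ j, ((v j - δ : ℝ) : EReal) ≤ (I (x j) : EReal))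
    (hu : ∀ j, 0 < α j → (I (x j)).toReal ≤ v j + δ) :
    Real.exp ((minCost α v - ∑ j, α j * v j - 2 * (∑ j, α j) * δ) / ε)
      ≤ Fintype.card (Equiv.Perm (Fin K)) * rho I α ε x := by
  have hpos : 0 < ∑ τ : Equiv.Perm (Fin K), expWeight I α ε (fun j => x (τ j)) :=
    ((expWeight_nonneg I α ε x).lt_of_ne' ((expWeight_ne_zero_iff hε).2 hx)).trans_le
      (le_sum_perm (expWeight_nonneg I α ε) x 1)
  have h1 : Real.exp (-(∑ j, α j * (v j + δ)) / ε) ≤ expWeight I α ε x := by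
    rw [expWeight_eq hε hα hx]
    refine Real.exp_le_exp.2 (div_le_div_of_nonneg_right (neg_le_neg ?_) hε.le)
    refine Finset.sum_le_sum fun j _ => ?_
    rcases (hα j).eq_or_lt with h0 | h0
    · simp [← h0]
    · exact mul_le_mul_of_nonneg_left (hu j h0) h0.le
  -- Every term of the denominator is bounded by the optimal exponent, up to the shift by `δ`; `hl`
  -- provides this even where `I` is infinite.
  have h2 : ∀ τ : Equiv.Perm (Fin K), expWeight I α ε (fun j => x (τ j))
      ≤ Real.exp (-(minCost α v - (∑ j, α j) * δ) / ε) := fun τ => by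
    refine (expWeight_le hε hα (c := fun j => v (τ j) - δ) fun j => hl (τ j)).trans ?_
    refine Real.exp_le_exp.2 (div_le_div_of_nonneg_right (neg_le_neg ?_) hε.le)
    have := minCost_le α v τ
    simp only [mul_sub, Finset.sum_sub_distrib, ← Finset.sum_mul]
    linarith
  have h3 : ∑ τ : Equiv.Perm (Fin K), expWeight I α ε (fun j => x (τ j))
      ≤ Fintype.card (Equiv.Perm (Fin K)) * Real.exp (-(minCost α v - (∑ j, α j) * δ) / ε) := by
    refine (Finset.sum_le_card_nsmul _ _ _ fun τ _ => h2 τ).trans ?_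
    rw [nsmul_eq_mul, Finset.card_univ]
  change _ ≤ _ * (expWeight I α ε x / ∑ τ : Equiv.Perm (Fin K), expWeight I α ε (fun j => x (τ j)))
  rw [mul_div_assoc', le_div_iff₀ hpos]
  refine (mul_le_mul_of_nonneg_left h3 (Real.exp_pos _).le).trans ?_
  rw [mul_left_comm, ← Real.exp_add]
  refine mul_le_mul_of_nonneg_left (le_trans (le_of_eq ?_) h1) (Nat.cast_nonneg _)
  congr 1
  simp only [mul_add, Finset.sum_add_distrib, ← Finset.sum_mul]
  ring

end ExpWeight

/-! ### Large deviation bounds at temperature ε / α -/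

section Temp

variable {S : Type*} [TopologicalSpace S] [MeasurableSpace S] {μ : ℝ≥0∞ → Measure S}
  {I : S → ℝ≥0∞}

lemma temp_of_pos {ε α : ℝ} (hα : 0 < α) : temp ε α = ENNReal.ofReal (ε / α) :=
  (ENNReal.ofReal_div_of_pos hα).symm

lemma tendsto_div_nhdsGT_zero {a : ℝ} (ha : 0 < a) :
    Tendsto (fun ε : ℝ => ε / a) (𝓝[>] 0) (𝓝[>] 0) := by
  refine tendsto_nhdsWithin_iff.2 ⟨?_, ?_⟩
  · have : Tendsto (fun ε : ℝ => ε / a) (𝓝 0) (𝓝 (0 / a)) := tendsto_id.div_const a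
    rw [zero_div] at this
    exact this.mono_left nhdsWithin_le_nhds
  · filter_upwards [self_mem_nhdsWithin] with ε hε using div_pos hε ha

lemma SatisfiesLDP.eventually_temp_le (h : SatisfiesLDP (fun ε => μ (ENNReal.ofReal ε)) I)
    {C : Set S} (hC : IsClosed C) {a b α : ℝ} (hα : 0 < α)
    (hI : ∀ x ∈ C, (a : EReal) ≤ (I x : EReal)) (hb : b < a) :
    ∀ᶠ ε in 𝓝[>] (0 : ℝ), μ (temp ε α) C ≤ ENNReal.ofReal (Real.exp (-(α * b) / ε)) := by
  filter_upwards [(tendsto_div_nhdsGT_zero hα).eventually (h.eventually_le hC hI hb)] with ε hε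
  rw [temp_of_pos hα]
  convert hε using 3
  rw [div_div_eq_mul_div]
  ring

lemma SatisfiesLDP.eventually_temp_ge (h : SatisfiesLDP (fun ε => μ (ENNReal.ofReal ε)) I)
    {U : Set S} (hU : IsOpen U) {x : S} (hx : x ∈ U) (hIx : I x ≠ ∞) {b α : ℝ} (hα : 0 < α)
    (hb : (I x).toReal < b) :
    ∀ᶠ ε in 𝓝[>] (0 : ℝ), ENNReal.ofReal (Real.exp (-(α * b) / ε)) ≤ μ (temp ε α) U := by
  filter_upwards [(tendsto_div_nhdsGT_zero hα).eventually (h.eventually_ge hU hx hIx hb)] with ε hε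
  rw [temp_of_pos hα]
  convert hε using 3
  rw [div_div_eq_mul_div]
  ring

end Temp

/-! ### Integral estimates -/

section Integration

variable {Ω : Type*} [MeasurableSpace Ω] {P : Measure Ω} {f : Ω → ℝ≥0∞}

lemma setLIntegral_le_mul {s : Set Ω} (hs : MeasurableSet s) {c : ℝ≥0∞}
    (h : ∀ᵐ x ∂P, x ∈ s → f x ≤ c) : ∫⁻ x in s, f x ∂P ≤ c * P s := by
  rw [← setLIntegral_const]
  exact setLIntegral_mono_ae' hs h

lemma mul_le_setLIntegral {s : Set Ω} (hs : MeasurableSet s) {c : ℝ≥0∞}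
    (h : ∀ᵐ x ∂P, x ∈ s → c ≤ f x) : c * P s ≤ ∫⁻ x in s, f x ∂P := by
  rw [← setLIntegral_const]
  exact setLIntegral_mono_ae' hs h

lemma lintegral_le_card_mul {β : Type*} [Fintype β] {s : β → Set Ω} (hs : ∀ x, ∃ b, x ∈ s b)
    {c : ℝ≥0∞} (h : ∀ b, ∫⁻ x in s b, f x ∂P ≤ c) : ∫⁻ x, f x ∂P ≤ Fintype.card β * c := by
  have hU : ⋃ b, s b = Set.univ := Set.eq_univ_of_forall fun x => Set.mem_iUnion.2 (hs x)
  calc ∫⁻ x, f x ∂P = ∫⁻ x in ⋃ b, s b, f x ∂P := by rw [hU, Measure.restrict_univ]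
    _ ≤ ∑' b, ∫⁻ x in s b, f x ∂P := lintegral_iUnion_le _ _
    _ = ∑ b, ∫⁻ x in s b, f x ∂P := tsum_fintype _
    _ ≤ _ := (Finset.sum_le_card_nsmul _ _ _ fun b _ => h b).trans_eq (by
        rw [nsmul_eq_mul, Finset.card_univ])

lemma ae_withDensity_ne_zero {γ : Measure Ω} {h : Ω → ℝ≥0} (hh : Measurable h) :
    ∀ᵐ x ∂(γ.withDensity fun x => (h x : ℝ≥0∞)), h x ≠ 0 := by
  rw [ae_withDensity_iff (by fun_prop)]
  exact Eventually.of_forall fun x hx => by simpa using hx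

lemma eventually_natCast_mul_exp_le (N : ℕ) {r s : ℝ} (hrs : r < s) :
    ∀ᶠ ε in 𝓝[>] (0 : ℝ), (N : ℝ≥0∞) * ENNReal.ofReal (Real.exp (-s / ε))
      ≤ ENNReal.ofReal (Real.exp (-r / ε)) := by
  filter_upwards [eventually_le_exp_div N (sub_pos.2 hrs)] with ε h
  rw [← ENNReal.ofReal_natCast, ← ENNReal.ofReal_mul (Nat.cast_nonneg _)]
  refine ENNReal.ofReal_le_ofReal ((mul_le_mul_of_nonneg_right h (Real.exp_pos _).le).trans
    (le_of_eq ?_))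
  rw [← Real.exp_add]
  congr 1
  ring

end Integration

/-! ### Exponential upper bound for the weighted moment -/

section Upper

variable {S : Type*} [TopologicalSpace S] [PolishSpace S] [MeasurableSpace S] [BorelSpace S]
  {K : ℕ} {α : Fin K → ℝ} {γ : Measure S} {μ : ℝ≥0∞ → Measure S}
  {g : ℝ≥0∞ → S → ℝ≥0} {I : S → ℝ≥0∞} {F : S → ℝ} {Fε : ℝ → S → ℝ}

lemma ae_pi_density_ne_zero {S : Type*} [MeasurableSpace S] {γ : Measure S}
    {μ : ℝ≥0∞ → Measure S} {g : ℝ≥0∞ → S → ℝ≥0} {ε : ℝ} (hμ : ∀ j, IsProbabilityMeasure (μ (temp ε (α j))))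
    (hg : ∀ j, Measurable (g (temp ε (α j))))
    (hμg : ∀ j, μ (temp ε (α j)) = γ.withDensity fun x => (g (temp ε (α j)) x : ℝ≥0∞)) :
    ∀ᵐ x ∂(Measure.pi fun j => μ (temp ε (α j))), ∀ j, g (temp ε (α j)) (x j) ≠ 0 := by
  refine ae_all_iff.2 fun j => ?_
  refine (Measure.tendsto_eval_ae_ae (μ := fun j => μ (temp ε (α j))) (i := j)).eventually
    (p := fun z => g (temp ε (α j)) z ≠ 0) ?_
  rw [hμg j]
  exact ae_withDensity_ne_zero (hg j)

/-- The bound of the weighted moment on a product of small sets. -/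
lemma setLIntegral_cell_le [NeZero K] (hα_one : α 0 = 1) (hα : ∀ j, 0 ≤ α j)
    {ε δ : ℝ} (hε : 0 < ε)
    (hμ : ∀ j, IsProbabilityMeasure (μ (temp ε (α j))))
    (hae : ∀ᵐ x ∂(Measure.pi fun j => μ (temp ε (α j))), ∀ j, g (temp ε (α j)) (x j) ≠ 0)
    {x₀ : S} (hx₀ : I x₀ = 0) {U : Set S} (hU : IsOpen U) (hx₀U : x₀ ∈ U)
    (hQ : ∀ x : Fin K → S, (∀ j, x j ∈ U) → LogRatioLT I g α δ ε x)
    {y : Fin K → S} {N : Fin K → Set S} (hN : ∀ j, MeasurableSet (N j))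
    (hNI : ∀ j, ∀ x ∈ N j, I x ≠ ∞ → |(I x).toReal - (I (y j)).toReal| ≤ δ)
    (hNF : ∀ x ∈ N 0, x ∈ U → F (y 0) - 2 * δ ≤ Fε ε x)
    (hNμ : ∀ j, 0 < α j → μ (temp ε (α j)) (N j)
      ≤ ENNReal.ofReal (Real.exp (-(α j * ((I (y j)).toReal - 2 * δ)) / ε)))
    {τ : Equiv.Perm (Fin K)} (hτ : ∀ j, ¬ 0 < α j → τ j = j) (hτ' : ∀ j, 0 < α j → 0 < α (τ j))
    {s : ℝ} (hs : s + (6 + 4 * ∑ j, α j) * δ ≤ 2 * ∑ j, α j * (I (y j)).toReal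
      - ∑ j, α j * (I (y (τ j))).toReal + 2 * F (y 0)) :
    ∫⁻ x in Set.univ.pi fun j => {z | 0 < α j → z ∈ N j ∧ z ∈ U},
      ENNReal.ofReal (rhoTilde g α ε x * Real.exp (-(1 / ε) * Fε ε (x 0)) ^ 2)
      ∂(Measure.pi fun j => μ (temp ε (α j))) ≤ ENNReal.ofReal (Real.exp (-s / ε)) := by
  set A := ∑ j, α j with hA
  set v : Fin K → ℝ := fun j => (I (y j)).toReal with hv
  have hms : ∀ j, MeasurableSet {z | 0 < α j → z ∈ N j ∧ z ∈ U} := fun j => by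
    by_cases hj : 0 < α j
    · simpa [hj] using (hN j).inter hU.measurableSet
    · simp [hj]
  have h0 : 0 < α 0 := by rw [hα_one]; exact one_pos
  have hpt : ∀ᵐ x ∂(Measure.pi fun j => μ (temp ε (α j))),
      x ∈ Set.univ.pi (fun j => {z | 0 < α j → z ∈ N j ∧ z ∈ U}) →
      ENNReal.ofReal (rhoTilde g α ε x * Real.exp (-(1 / ε) * Fε ε (x 0)) ^ 2)
      ≤ ENNReal.ofReal (Real.exp ((2 * δ - ∑ j, α j * v j + ∑ j, α j * v (τ j) + 2 * A * δ
        - 2 * (F (y 0) - 2 * δ)) / ε)) := by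
    filter_upwards [hae] with x hx hxc
    have hxc' : ∀ j, 0 < α j → x j ∈ N j ∧ x j ∈ U := fun j hj => hxc j trivial hj
    -- Moving the coordinates with `α j = 0` to `x₀` brings the whole point into the region where
    -- the ratio of the weights is controlled.
    set x' : Fin K → S := fun j => if 0 < α j then x j else x₀ with hx'
    have hx'U : ∀ j, x' j ∈ U := fun j => by
      simp only [hx']
      split_ifs with hj
      exacts [(hxc' j hj).2, hx₀U]
    obtain ⟨hfin, hle⟩ := rhoTilde_le hε hα hx₀ hτ hτ' (x' := x') (fun j => rfl) hx
      (hQ _ fun _ => hx₀U) (hQ _ hx'U) (hQ _ fun j => hx'U (τ j))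
    have hexp : Real.exp (-(1 / ε) * Fε ε (x 0)) ^ 2 ≤ Real.exp (-(2 * (F (y 0) - 2 * δ)) / ε) := by
      rw [← Real.exp_nat_mul]
      refine Real.exp_le_exp.2 ?_
      have := hNF (x 0) (hxc' 0 h0).1 (hxc' 0 h0).2
      have h2 : (2 : ℕ) * (-(1 / ε) * Fε ε (x 0)) = -(2 * Fε ε (x 0)) / ε := by
        push_cast; ring
      rw [h2]
      exact div_le_div_of_nonneg_right (by linarith) hε.le
    refine ENNReal.ofReal_le_ofReal ((mul_le_mul hle hexp (by positivity) (by positivity)).trans ?_)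
    rw [← Real.exp_add, ← add_div]
    refine Real.exp_le_exp.2 (div_le_div_of_nonneg_right ?_ hε.le)
    have hsum : ∑ j, α j * v j - A * δ ≤ ∑ j, α j * (I (x j)).toReal := by
      rw [hA, Finset.sum_mul, ← Finset.sum_sub_distrib]
      refine Finset.sum_le_sum fun j _ => ?_
      rcases (hα j).eq_or_lt with hj | hj
      · simp [← hj]
      · rw [← mul_sub]
        refine mul_le_mul_of_nonneg_left ?_ hj.le
        linarith [(abs_le.1 (hNI j _ (hxc' j hj).1 (hfin j hj))).1]
    have hsum' : ∑ j, α j * (I (x (τ j))).toReal ≤ ∑ j, α j * v (τ j) + A * δ := by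
      rw [hA, Finset.sum_mul, ← Finset.sum_add_distrib]
      refine Finset.sum_le_sum fun j _ => ?_
      rcases (hα j).eq_or_lt with hj | hj
      · simp [← hj]
      · rw [← mul_add]
        refine mul_le_mul_of_nonneg_left ?_ hj.le
        linarith [(abs_le.1 (hNI (τ j) _ (hxc' _ (hτ' j hj)).1 (hfin _ (hτ' j hj)))).2]
    linarith
  have hmeas : Measure.pi (fun j => μ (temp ε (α j)))
      (Set.univ.pi fun j => {z | 0 < α j → z ∈ N j ∧ z ∈ U})
      ≤ ENNReal.ofReal (Real.exp (-(∑ j, α j * v j - 2 * A * δ) / ε)) := by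
    have h1 : -(∑ j, α j * v j - 2 * A * δ) / ε = ∑ j, -(α j * (v j - 2 * δ)) / ε := by
      rw [← Finset.sum_div, Finset.sum_neg_distrib]
      simp only [mul_sub, Finset.sum_sub_distrib, ← Finset.sum_mul, hA]
      ring
    rw [h1, Real.exp_sum, ENNReal.ofReal_prod_of_nonneg fun _ _ => (Real.exp_pos _).le,
      Measure.pi_pi]
    refine Finset.prod_le_prod' fun j _ => ?_
    -- A coordinate with `α j = 0` is unconstrained, and its factor 1 = exp 0 matches the zero
    -- exponent.
    rcases (hα j).eq_or_lt with hj | hj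
    · exact prob_le_one.trans (by simp [← hj])
    · exact (measure_mono fun z hz => (hz hj).1).trans (hNμ j hj)
  refine (setLIntegral_le_mul (MeasurableSet.univ_pi hms) hpt).trans
    ((mul_le_mul_right hmeas _).trans ?_)
  rw [← ENNReal.ofReal_mul (Real.exp_pos _).le, ← Real.exp_add, ← add_div]
  refine ENNReal.ofReal_le_ofReal (Real.exp_le_exp.2 (div_le_div_of_nonneg_right ?_ hε.le))
  linarith

/-- A neighbourhood of a high compact level set is covered by finitely many small sets, and each
product cell is bounded through the cost at its centres. When a coordinate with positive `α j`
leaves the neighbourhood, the bound ρ̃ ≤ 1 and the decay of the tail suffice. -/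
theorem eventually_weightedMoment_le [NeZero K] (hα_one : α 0 = 1) (hα_anti : Antitone α)
    (hα_nonneg : ∀ j, 0 ≤ α j)
    (hμ : ∀ ε : ℝ, 0 < ε → ∀ j, IsProbabilityMeasure (μ (temp ε (α j))))
    (hg : ∀ ε : ℝ, 0 < ε → ∀ j, Measurable (g (temp ε (α j))))
    (hμg : ∀ ε : ℝ, 0 < ε → ∀ j, μ (temp ε (α j)) =
      γ.withDensity fun x => (g (temp ε (α j)) x : ℝ≥0∞))
    (hLDP : SatisfiesLDP (fun ε => μ (ENNReal.ofReal ε)) I)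
    (hI : ContinuousOn I {x | I x ≠ ∞}) (hF : Continuous F)
    (hρ : LogRatioTendstoZero I g α)
    (hFε : ∀ C : Set S, IsCompact C → TendstoUniformlyOn Fε F (𝓝[>] 0) C)
    (hFε_bdd : ∃ b : ℝ, ∀ ε ∈ Set.Ioo (0 : ℝ) 1, ∀ x, b ≤ Fε ε x)
    {r : ℝ} (hr : (r : EReal) < V I F α) :
    ∀ᶠ ε in 𝓝[>] (0 : ℝ), weightedMoment μ g Fε α ε ≤ ENNReal.ofReal (Real.exp (-r / ε)) := by
  classical
  obtain ⟨b, hb⟩ := hFε_bdd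
  obtain ⟨r₁, hr₁, hr₁V⟩ := EReal.lt_iff_exists_real_btwn.1 hr
  rw [EReal.coe_lt_coe_iff] at hr₁
  set A := ∑ j, α j with hA
  have hA0 : 0 ≤ A := Finset.sum_nonneg fun j _ => hα_nonneg j
  -- Half of the gap between `r` and `r₁` absorbs the number of cells, the other half the errors on
  -- a cell: 2δ from the log ratio, 4δ from `F`, and 2Aδ each from the weight and from the
  -- probability.
  set s := (r + r₁) / 2 with hs
  set δ := (r₁ - s) / (6 + 4 * A) with hδ
  have hδ0 : 0 < δ := div_pos (by linarith) (by linarith)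
  have hδA : s + (6 + 4 * A) * δ = r₁ := by rw [hδ]; field_simp; ring
  have h0 : 0 < α 0 := by rw [hα_one]; exact one_pos
  have hν : ∀ ε, 0 < ε → IsProbabilityMeasure (μ (ENNReal.ofReal ε)) := fun ε hε => by
    have := hμ ε hε 0
    rwa [hα_one, temp_of_pos one_pos, div_one] at this
  obtain ⟨x₀, hx₀⟩ := hLDP.exists_eq_zero hν
  -- The level makes `α j * a` at least `s - 2 * b` whenever `0 < α j`, so the tail outweighs the
  -- factor `exp (-2b/ε)` left by the lower bound on `Fε`. Terms with `α j = 0` are 0 because `x / 0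
  -- = 0`.
  set a : ℝ := ∑ j, |(s - 2 * b) / α j| with ha
  have ha0 : 0 ≤ a := Finset.sum_nonneg fun j _ => abs_nonneg _
  have haj : ∀ j, 0 < α j → s - 2 * b ≤ α j * a := fun j hj => by
    have h1 : |(s - 2 * b) / α j| ≤ a :=
      Finset.single_le_sum (f := fun j => |(s - 2 * b) / α j|) (fun j _ => abs_nonneg _)
        (Finset.mem_univ j)
    have h2 := (le_abs_self _).trans h1
    rwa [div_le_iff₀' hj] at h2
  -- The extra 1 provides the strict gap that the upper large deviation bound needs.
  set C : Set S := {x | I x ≤ ((a + 1).toNNReal : ℝ≥0)} with hC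
  have hCc : IsCompact C := hLDP.rate _
  have hCfin : ∀ x ∈ C, I x ≠ ∞ := fun x hx => ne_top_of_le_ne_top ENNReal.coe_ne_top hx
  -- uniform control on a neighbourhood of `C`
  obtain ⟨O, hO, hCO, hOε⟩ := exists_isOpen_of_forall_isCompact
    (P := fun ε x => LogRatioLT I g α δ ε x) (fun C hC => hρ C hC δ hδ0)
    (isCompact_univ_pi fun _ : Fin K => hCc)
  obtain ⟨U₁, hU₁, hCU₁, hU₁O⟩ := exists_isOpen_pi_subset hCc hO hCO
  obtain ⟨U₂, hU₂, hCU₂, hU₂ε⟩ := exists_isOpen_of_forall_isCompact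
    (P := fun ε x => dist (F x) (Fε ε x) < δ)
    (fun C hC => Metric.tendstoUniformlyOn_iff.1 (hFε C hC) δ hδ0) hCc
  -- small closed neighbourhoods
  have hnb : ∀ y : S, ∃ N ∈ 𝓝 y, IsClosed N ∧ (y ∈ C → ∀ x ∈ N,
      ((((I y).toReal - δ : ℝ) : EReal) ≤ (I x : EReal) ∧
      (I x ≠ ∞ → |(I x).toReal - (I y).toReal| ≤ δ)) ∧ dist (F x) (F y) < δ) := fun y => by
    by_cases hy : y ∈ C
    · have h1 := (hLDP.rate.eventually_near hI (hCfin y hy) hδ0).and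
        (hF.continuousAt.eventually (Metric.ball_mem_nhds (F y) hδ0))
      obtain ⟨N, hN, hNc, hN'⟩ := exists_mem_nhds_isClosed_subset h1
      exact ⟨N, hN, hNc, fun _ x hx => hN' hx⟩
    · exact ⟨Set.univ, univ_mem, isClosed_univ, fun h => absurd h hy⟩
  choose N hNn hNc hN using hnb
  obtain ⟨t, htC, hCt⟩ := hCc.elim_nhds_subcover (fun y => interior (N y))
    fun y _ => interior_mem_nhds.2 (hNn y)
  set U := U₁ ∩ U₂ ∩ ⋃ y ∈ t, interior (N y) with hU
  have hUo : IsOpen U := (hU₁.inter hU₂).inter (isOpen_biUnion fun y _ => isOpen_interior)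
  have hCU : C ⊆ U := Set.subset_inter (Set.subset_inter hCU₁ hCU₂) hCt
  have htail : ∀ x ∈ Uᶜ, ((a + 1 : ℝ) : EReal) ≤ (I x : EReal) := fun x hx => by
    have h1 : ¬ I x ≤ ENNReal.ofReal (a + 1) := fun h => hx (hCU h)
    have h2 := EReal.coe_ennreal_le_coe_ennreal_iff.2 (not_le.1 h1).le
    rwa [EReal.coe_ennreal_ofReal, max_eq_left (by linarith)] at h2
  -- the probabilities
  have hNμ : ∀ᶠ ε in 𝓝[>] (0 : ℝ), ∀ y ∈ t, ∀ j, 0 < α j → μ (temp ε (α j)) (N y)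
      ≤ ENNReal.ofReal (Real.exp (-(α j * ((I y).toReal - 2 * δ)) / ε)) := by
    refine (Filter.eventually_all_finset t).2 fun y hy => eventually_all.2 fun j => ?_
    by_cases hj : 0 < α j
    · filter_upwards [hLDP.eventually_temp_le (hNc y) hj (fun x hx => (hN y (htC y hy) x hx).1.1)
        (show (I y).toReal - 2 * δ < (I y).toReal - δ by linarith)] with ε h _ using h
    · exact Eventually.of_forall fun ε h => absurd h hj
  have hUμ : ∀ᶠ ε in 𝓝[>] (0 : ℝ), ∀ j, 0 < α j → μ (temp ε (α j)) Uᶜ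
      ≤ ENNReal.ofReal (Real.exp (-(α j * a) / ε)) := by
    refine eventually_all.2 fun j => ?_
    by_cases hj : 0 < α j
    · filter_upwards [hLDP.eventually_temp_le hUo.isClosed_compl hj htail (lt_add_one a)]
        with ε h _ using h
    · exact Eventually.of_forall fun ε h => absurd h hj
  filter_upwards [hNμ, hUμ, hOε, hU₂ε, Ioo_mem_nhdsGT one_pos, eventually_natCast_mul_exp_le
    (Fintype.card ((Fin K → t) ⊕ {j // 0 < α j})) (show r < s by linarith)]
    with ε hNμ hUμ hQ hFU hε1 hcard
  have hε := hε1.1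
  have hprob := hμ ε hε
  refine le_trans ?_ hcard
  -- The cells constrain only coordinates with `0 < α j`; a point in none of them has such a
  -- coordinate outside `U`.
  refine lintegral_le_card_mul (s := Sum.elim
    (fun κ : Fin K → t => Set.univ.pi fun j => {z | 0 < α j → z ∈ N (κ j) ∧ z ∈ U})
    (fun j : {j // 0 < α j} => Function.eval j.1 ⁻¹' Uᶜ)) (fun x => ?_) (fun β => ?_)
  · by_cases hx : ∀ j, 0 < α j → x j ∈ U
    · have h1 : ∀ j, ∃ y : t, 0 < α j → x j ∈ N y := fun j => by
        by_cases hj : 0 < α j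
        · obtain ⟨y, hy, hxy⟩ := Set.mem_iUnion₂.1 (hx j hj).2
          exact ⟨⟨y, hy⟩, fun _ => interior_subset hxy⟩
        · obtain ⟨y, hy, -⟩ := Set.mem_iUnion₂.1 (hx 0 h0).2
          exact ⟨⟨y, hy⟩, fun h => absurd h hj⟩
      choose κ hκ using h1
      exact ⟨Sum.inl κ, fun j _ hj => ⟨hκ j hj, hx j hj⟩⟩
    · push Not at hx
      obtain ⟨j, hj, hxj⟩ := hx
      exact ⟨Sum.inr ⟨j, hj⟩, hxj⟩
  · rcases β with κ | ⟨j, hj⟩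
    · obtain ⟨τ, w, hτ, hτ', hw, hw0, hcost⟩ := exists_perm_cost hα_anti hα_nonneg 0 h0
        (v := fun j => (I (κ j : S)).toReal) fun j => ENNReal.toReal_nonneg
      have hκC : ∀ j, (κ j : S) ∈ C := fun j => htC _ (κ j).2
      have hV := hr₁V.le.trans (V_le (I := I) (F := F) (α := α) hw (hCfin _ (hκC 0)) hw0.symm)
      rw [EReal.coe_le_coe_iff] at hV
      refine setLIntegral_cell_le (F := F) hα_one hα_nonneg hε hprob
        (ae_pi_density_ne_zero hprob (hg ε hε) (hμg ε hε)) hx₀ hUo (hCU (by simp [hC, hx₀]))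
        (fun x hx => hQ x (hU₁O fun j _ => (hx j).1.1)) (y := fun j => κ j)
        (fun j => (hNc _).measurableSet) (fun j x hx => (hN _ (hκC j) x hx).1.2)
        (fun x hx hxU => ?_) (fun j hj => hNμ _ (κ j).2 j hj) hτ hτ' ?_
      · have h1 := abs_lt.1 (hN _ (hκC 0) x hx).2
        have h2 := abs_lt.1 (hFU x hxU.1.2)
        linarith [h1.1, h2.2]
      · rw [hδA]
        linarith
    · refine (setLIntegral_le_mul (c := ENNReal.ofReal (Real.exp (-(2 * b) / ε)))
        (hUo.measurableSet.compl.preimage (measurable_pi_apply j)) ?_).trans ?_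
      · refine Eventually.of_forall fun x _ => ENNReal.ofReal_le_ofReal ?_
        have h1 : Real.exp (-(1 / ε) * Fε ε (x 0)) ^ 2 ≤ Real.exp (-(2 * b) / ε) := by
          rw [← Real.exp_nat_mul]
          refine Real.exp_le_exp.2 ?_
          have h2 : (2 : ℕ) * (-(1 / ε) * Fε ε (x 0)) = -(2 * Fε ε (x 0)) / ε := by
            push_cast; ring
          rw [h2]
          exact div_le_div_of_nonneg_right (by linarith [hb ε hε1 (x 0)]) hε.le
        refine (mul_le_mul (symWeight_le_one (densWeight_nonneg g α ε) x) h1 (by positivity)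
          zero_le_one).trans_eq (one_mul _)
      · have h1 : Measure.pi (fun j => μ (temp ε (α j))) (Function.eval j ⁻¹' Uᶜ)
            = μ (temp ε (α j)) Uᶜ :=
          (measurePreserving_eval (fun j => μ (temp ε (α j))) j).measure_preimage
            hUo.measurableSet.compl.nullMeasurableSet
        change _ * Measure.pi (fun j => μ (temp ε (α j))) (Function.eval j ⁻¹' Uᶜ) ≤ _
        rw [h1]
        refine (mul_le_mul_right (hUμ j hj) _).trans ?_
        rw [← ENNReal.ofReal_mul (Real.exp_pos _).le, ← Real.exp_add, ← add_div]
        refine ENNReal.ofReal_le_ofReal (Real.exp_le_exp.2 (div_le_div_of_nonneg_right ?_ hε.le))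
        linarith [haj j hj]

end Upper

/-! ### Exponential lower bound for the weighted moment -/

section Lower

variable {S : Type*} [TopologicalSpace S] [PolishSpace S] [MeasurableSpace S] [BorelSpace S]
  {K : ℕ} [NeZero K] {α : Fin K → ℝ} {γ : Measure S} {μ : ℝ≥0∞ → Measure S}
  {g : ℝ≥0∞ → S → ℝ≥0} {I : S → ℝ≥0∞} {F : S → ℝ} {Fε : ℝ → S → ℝ}

/-- Exponential lower bound for the probability of a neighbourhood, for positive and infinite
temperatures alike. -/
lemma eventually_le_measure_nhds {S : Type*} [TopologicalSpace S] [MeasurableSpace S]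
    {γ : Measure S} {μ : ℝ≥0∞ → Measure S} {g : ℝ≥0∞ → S → ℝ≥0} {I : S → ℝ≥0∞} (hα_one : α 0 = 1) (hα_nonneg : ∀ j, 0 ≤ α j)
    (hg : ∀ ε : ℝ, 0 < ε → ∀ j, Measurable (g (temp ε (α j))))
    (hμg : ∀ ε : ℝ, 0 < ε → ∀ j, μ (temp ε (α j)) =
      γ.withDensity fun x => (g (temp ε (α j)) x : ℝ≥0∞))
    (hLDP : SatisfiesLDP (fun ε => μ (ENNReal.ofReal ε)) I)
    {y : Fin K → S} (hy : ∀ j, I (y j) ≠ ∞) {N : Fin K → Set S} (hN : ∀ j, IsOpen (N j))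
    (hyN : ∀ j, y j ∈ N j)
    (hzero : ∀ᶠ ε in 𝓝[>] (0 : ℝ), ∀ x ∈ Set.univ.pi N,
      (densWeight g α ε x = 0 ↔ expWeight I α ε x = 0))
    {δ : ℝ} (hδ : 0 < δ) (j : Fin K) :
    ∀ᶠ ε in 𝓝[>] (0 : ℝ), ENNReal.ofReal (Real.exp (-(α j * (I (y j)).toReal + δ) / ε))
      ≤ μ (temp ε (α j)) (N j) := by
  rcases (hα_nonneg j).eq_or_lt with hj | hj
  · have htop : ∀ ε : ℝ, 0 < ε → temp ε (α j) = ∞ := fun ε hε => by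
      rw [temp, ← hj, ENNReal.ofReal_zero, ENNReal.div_zero (by simpa using hε)]
    -- Replacing the `j`-th coordinate of `y` by any point of `N j` keeps the weight positive, so
    -- the density at temperature ∞ is nonzero on `N j`. If `N j` were null, it would be null for
    -- `γ`, hence for the measure at temperature `ε`, against the lower large deviation bound.
    have hne : μ ∞ (N j) ≠ 0 := by
      obtain ⟨ε, h1, h2, hε⟩ := ((hLDP.eventually_ge (hN j) (hyN j) (hy j)
        (lt_add_one (I (y j)).toReal)).and (hzero.and self_mem_nhdsWithin)).exists
      have hε : 0 < ε := hε
      intro h0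
      rw [← htop ε hε, hμg ε hε j, withDensity_apply_eq_zero (by have := hg ε hε j; fun_prop)] at h0
      have hsub : N j ⊆ {x | (g (temp ε (α j)) x : ℝ≥0∞) ≠ 0} ∩ N j := fun z hz => by
        refine ⟨fun hgz => ?_, hz⟩
        have hmem : Function.update y j z ∈ Set.univ.pi N := fun i _ => by
          by_cases hi : i = j
          · subst hi; simpa using hz
          · simpa [hi] using hyN i
        have h3 : expWeight I α ε (Function.update y j z) ≠ 0 :=
          (expWeight_ne_zero_iff hε).2 fun i hi => by
            have hij : i ≠ j := fun h => by rw [h, ← hj] at hi; exact lt_irrefl _ hi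
            simpa [hij] using hy i
        refine h3 ((h2 _ hmem).1 (Finset.prod_eq_zero (Finset.mem_univ j) ?_))
        simpa using hgz
      have h4 : γ (N j) = 0 := measure_mono_null hsub h0
      have h5 : μ (ENNReal.ofReal ε) (N j) = 0 := by
        have := hμg ε hε 0
        rw [hα_one, temp_of_pos one_pos, div_one] at this
        rw [this]
        exact withDensity_absolutelyContinuous _ _ h4
      rw [h5] at h1
      exact absurd h1 (not_le.2 (ENNReal.ofReal_pos.2 (Real.exp_pos _)))
    -- The mass is a positive constant, so `exp (δ / ε)` eventually exceeds its inverse.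
    filter_upwards [eventually_le_exp_div ((μ ∞ (N j))⁻¹).toReal hδ, self_mem_nhdsWithin]
      with ε h1 hε
    rw [htop ε hε, ← hj, zero_mul, zero_add, neg_div, Real.exp_neg,
      ENNReal.ofReal_inv_of_pos (Real.exp_pos _), ENNReal.inv_le_iff_inv_le]
    rwa [ENNReal.le_ofReal_iff_toReal_le (ENNReal.inv_ne_top.2 hne) (Real.exp_pos _).le]
  · have h := hLDP.eventually_temp_ge (hN j) (hyN j) (hy j) hj
      (lt_add_of_pos_right (I (y j)).toReal (div_pos hδ hj))
    filter_upwards [h] with ε hε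
    rwa [mul_add, mul_div_cancel₀ _ hj.ne'] at hε

/-- The integral over a small box suffices. Its centre has a nearly optimal point `x` in the
coordinates of `B` and a zero of `I` in all others. -/
theorem eventually_le_weightedMoment (hα_one : α 0 = 1) (hα_anti : Antitone α)
    (hα_nonneg : ∀ j, 0 ≤ α j)
    (hμ : ∀ ε : ℝ, 0 < ε → ∀ j, IsProbabilityMeasure (μ (temp ε (α j))))
    (hg : ∀ ε : ℝ, 0 < ε → ∀ j, Measurable (g (temp ε (α j))))
    (hμg : ∀ ε : ℝ, 0 < ε → ∀ j, μ (temp ε (α j)) =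
      γ.withDensity fun x => (g (temp ε (α j)) x : ℝ≥0∞))
    (hLDP : SatisfiesLDP (fun ε => μ (ENNReal.ofReal ε)) I)
    (hI : ContinuousOn I {x | I x ≠ ∞}) (hF : Continuous F)
    (hρ : LogRatioTendstoZero I g α)
    (hFε : ∀ C : Set S, IsCompact C → TendstoUniformlyOn Fε F (𝓝[>] 0) C)
    {r : ℝ} (hr : V I F α < r) :
    ∀ᶠ ε in 𝓝[>] (0 : ℝ), ENNReal.ofReal (Real.exp (-r / ε)) ≤ weightedMoment μ g Fε α ε := by
  have hν : ∀ ε, 0 < ε → IsProbabilityMeasure (μ (ENNReal.ofReal ε)) := fun ε hε => by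
    have := hμ ε hε 0
    rwa [hα_one, temp_of_pos one_pos, div_one] at this
  obtain ⟨x₀, hx₀⟩ := hLDP.exists_eq_zero hν
  obtain ⟨x, B, hIx, hB, hxB⟩ := exists_cost_lt_of_V_lt hα_anti hα_nonneg hr
  set y : Fin K → S := fun j => if j ∈ B then x else x₀ with hy
  have hy0 : y 0 = x := if_pos hB
  have hyI : ∀ j, I (y j) ≠ ∞ := fun j => by
    simp only [hy]; split_ifs
    exacts [hIx, by simp [hx₀]]
  set v : Fin K → ℝ := fun j => (I (y j)).toReal with hv
  have hvB : v = fun j => if j ∈ B then (I x).toReal else 0 := by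
    funext j
    simp only [hv, hy]
    split_ifs <;> simp [hx₀]
  rw [← hvB, cost] at hxB
  set A := ∑ j, α j with hA
  have hA0 : 0 ≤ A := Finset.sum_nonneg fun j _ => hα_nonneg j
  -- The denominator collects the errors: 2A from `le_rho`, 2 from the factor K! and the log ratio,
  -- 4 from `F`, and K from the probability of the box.
  set δ := (r - (2 * ∑ j, α j * v j - minCost α v + 2 * F x)) / (2 * A + 6 + K) with hδ
  have hden : 0 < 2 * A + 6 + K := by positivity
  have hδ0 : 0 < δ := div_pos (by linarith) hden
  have hδA : 2 * ∑ j, α j * v j - minCost α v + 2 * F x + (2 * A + 6 + K) * δ = r := by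
    rw [hδ]; field_simp; ring
  -- a box around `y` on which everything is controlled
  have hQ := eventually_prod_nhds_of_forall_isCompact (P := fun ε x => LogRatioLT I g α δ ε x)
    (fun C hC => hρ C hC δ hδ0) y
  have hFl := eventually_prod_nhds_of_forall_isCompact (P := fun ε x => dist (F x) (Fε ε x) < δ)
    (fun C hC => Metric.tendstoUniformlyOn_iff.1 (hFε C hC) δ hδ0) (y 0)
  have hFl' : ∀ᶠ p in 𝓝[>] (0 : ℝ) ×ˢ 𝓝 y, dist (F (p.2 0)) (Fε p.1 (p.2 0)) < δ :=
    (tendsto_fst.prodMk ((continuous_apply 0).continuousAt.tendsto.comp tendsto_snd)).eventually hFl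
  have hloc : ∀ᶠ z in 𝓝 y, dist (F (z 0)) (F (y 0)) < δ ∧ ∀ j,
      ((v j - δ : ℝ) : EReal) ≤ (I (z j) : EReal) ∧
      (I (z j) ≠ ∞ → |(I (z j)).toReal - v j| ≤ δ) := by
    refine Filter.Eventually.and ?_ (eventually_all.2 fun j => ?_)
    · exact (hF.comp (continuous_apply 0)).continuousAt.eventually (Metric.ball_mem_nhds _ hδ0)
    · exact (show Tendsto (fun z : Fin K → S => z j) (𝓝 y) (𝓝 (y j)) from
        (continuous_apply j).tendsto y).eventually (hLDP.rate.eventually_near hI (hyI j) hδ0)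
  obtain ⟨pa, ha, pb, hb, hab⟩ :=
    eventually_prod_iff.1 ((hQ.and hFl').and (hloc.prod_inr (𝓝[>] (0 : ℝ))))
  obtain ⟨O, hO, hOo, hyO⟩ := eventually_nhds_iff.1 hb
  obtain ⟨N, hN, hNO⟩ := isOpen_pi_iff'.1 hOo y hyO
  have hbox : ∀ᶠ ε in 𝓝[>] (0 : ℝ), ∀ z ∈ Set.univ.pi N, (LogRatioLT I g α δ ε z ∧
      dist (F (z 0)) (Fε ε (z 0)) < δ) ∧ dist (F (z 0)) (F (y 0)) < δ ∧ ∀ j,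
      ((v j - δ : ℝ) : EReal) ≤ (I (z j) : EReal) ∧
      (I (z j) ≠ ∞ → |(I (z j)).toReal - v j| ≤ δ) :=
    ha.mono fun ε hε z hz => hab hε (hO z (hNO hz))
  have hprob := eventually_all.2 (eventually_le_measure_nhds hα_one hα_nonneg hg hμg hLDP hyI
    (fun j => (hN j).1) (fun j => (hN j).2)
    (hbox.mono fun ε h z hz => (h z hz).1.1.densWeight_eq_zero_iff) hδ0)
  filter_upwards [hbox, hprob, self_mem_nhdsWithin,
    eventually_le_exp_div (Fintype.card (Equiv.Perm (Fin K))) hδ0] with ε hbox hprob hε hcard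
  have hε : 0 < ε := hε
  have hμε := hμ ε hε
  have hpt : ∀ᵐ z ∂(Measure.pi fun j => μ (temp ε (α j))), z ∈ Set.univ.pi N →
      ENNReal.ofReal (Real.exp ((minCost α v - ∑ j, α j * v j - 2 * A * δ - 2 * δ
        - 2 * (F x + 2 * δ)) / ε))
      ≤ ENNReal.ofReal (rhoTilde g α ε z * Real.exp (-(1 / ε) * Fε ε (z 0)) ^ 2) := by
    filter_upwards [ae_pi_density_ne_zero hμε (hg ε hε) (hμg ε hε)] with z hz hzN
    obtain ⟨⟨hQz, hFz⟩, hFz', hIz⟩ := hbox z hzN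
    have hd : densWeight g α ε z ≠ 0 :=
      Finset.prod_ne_zero_iff.2 fun j _ => by exact_mod_cast hz j
    have hfin := (expWeight_ne_zero_iff hε).1 fun h => hd (hQz.densWeight_eq_zero_iff.2 h)
    have h1 := le_rho hε hα_nonneg (v := v) (δ := δ) hfin (fun j => (hIz j).1) fun j hj => by
      linarith [(abs_le.1 ((hIz j).2 (hfin j hj))).2]
    have h2 : Real.exp ((minCost α v - ∑ j, α j * v j - 2 * A * δ - 2 * δ) / ε)
        ≤ rhoTilde g α ε z := by
      have h3 : Real.exp ((minCost α v - ∑ j, α j * v j - 2 * A * δ) / ε)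
          ≤ Real.exp (δ / ε) * (Real.exp (δ / ε) * rhoTilde g α ε z) :=
        h1.trans (mul_le_mul hcard (hQz.le hε).2
          (symWeight_nonneg (expWeight_nonneg I α ε) z) (Real.exp_pos _).le)
      rw [← mul_assoc, ← Real.exp_add, ← div_le_iff₀' (Real.exp_pos _), ← Real.exp_sub] at h3
      refine le_trans (le_of_eq ?_) h3
      congr 1
      ring
    have h4 : Real.exp (-(2 * (F x + 2 * δ)) / ε) ≤ Real.exp (-(1 / ε) * Fε ε (z 0)) ^ 2 := by
      rw [← Real.exp_nat_mul]
      have h5 : (2 : ℕ) * (-(1 / ε) * Fε ε (z 0)) = -(2 * Fε ε (z 0)) / ε := by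
        push_cast; ring
      rw [h5]
      refine Real.exp_le_exp.2 (div_le_div_of_nonneg_right ?_ hε.le)
      rw [hy0] at hFz'
      linarith [(abs_lt.1 hFz).1, (abs_lt.1 hFz').2]
    refine ENNReal.ofReal_le_ofReal (le_trans (le_of_eq ?_)
      (mul_le_mul h2 h4 (Real.exp_pos _).le ((Real.exp_pos _).le.trans h2)))
    rw [← Real.exp_add]
    congr 1
    ring
  have hmeas : ENNReal.ofReal (Real.exp (-(∑ j, α j * v j + K * δ) / ε))
      ≤ Measure.pi (fun j => μ (temp ε (α j))) (Set.univ.pi N) := by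
    have h1 : -(∑ j, α j * v j + K * δ) / ε = ∑ j, -(α j * v j + δ) / ε := by
      rw [← Finset.sum_div, Finset.sum_neg_distrib, Finset.sum_add_distrib]
      simp
    rw [h1, Real.exp_sum, ENNReal.ofReal_prod_of_nonneg fun _ _ => (Real.exp_pos _).le,
      Measure.pi_pi]
    exact Finset.prod_le_prod' fun j _ => hprob j
  calc ENNReal.ofReal (Real.exp (-r / ε))
      = ENNReal.ofReal (Real.exp ((minCost α v - ∑ j, α j * v j - 2 * A * δ - 2 * δ
          - 2 * (F x + 2 * δ)) / ε))
        * ENNReal.ofReal (Real.exp (-(∑ j, α j * v j + K * δ) / ε)) := by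
        rw [← ENNReal.ofReal_mul (Real.exp_pos _).le, ← Real.exp_add, ← add_div, ← hδA]
        congr 3
        ring
    _ ≤ _ := mul_le_mul_right hmeas _
    _ ≤ _ := mul_le_setLIntegral
        (MeasurableSet.univ_pi fun j => (hN j).1.measurableSet) hpt
    _ ≤ _ := setLIntegral_le_lintegral _ _

end Lower

end INS

end

/-! ### The limit of the second moment -/

theorem theorem3 {𝓧 : Type*} [TopologicalSpace 𝓧] [PolishSpace 𝓧]
    [MeasurableSpace 𝓧] [BorelSpace 𝓧]
    -- the number of temperatures and the parameters `1 = α₁ ≥ ⋯ ≥ α_K ≥ 0`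
    (K : ℕ) [NeZero K] (α : Fin K → ℝ) (hα_one : α 0 = 1) (hα_anti : Antitone α)
    (hα_nonneg : ∀ j, 0 ≤ α j)
    -- probability measures `μ^t` with densities `g^t`, for the temperatures `t = ε / α_j`, `ε > 0`
    -- (every `t ∈ (0, ∞)`, because `α₁ = 1`; also `t = ∞` if some `α_j` is `0`)
    (γ : MeasureTheory.Measure 𝓧) [MeasureTheory.SigmaFinite γ]
    (μ : ℝ≥0∞ → MeasureTheory.Measure 𝓧) (g : ℝ≥0∞ → 𝓧 → ℝ≥0)
    (hμ : ∀ ε : ℝ, 0 < ε → ∀ j, MeasureTheory.IsProbabilityMeasure (μ (INS.temp ε (α j))))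
    (hg : ∀ ε : ℝ, 0 < ε → ∀ j, Measurable (g (INS.temp ε (α j))))
    (hμg : ∀ ε : ℝ, 0 < ε → ∀ j, μ (INS.temp ε (α j)) =
      γ.withDensity fun x => (g (INS.temp ε (α j)) x : ℝ≥0∞))
    -- the large deviation principle
    (I : 𝓧 → ℝ≥0∞) (hLDP : INS.SatisfiesLDP (fun ε => μ (ENNReal.ofReal ε)) I)
    (hI : ContinuousOn I {x | I x ≠ ∞})
    (F : 𝓧 → ℝ) (hF : Continuous F) (hF_bdd : BddBelow (Set.range F))
    (Fε : ℝ → 𝓧 → ℝ) (hFε_meas : ∀ ε : ℝ, 0 < ε → Measurable (Fε ε))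
    (hρ : INS.LogRatioTendstoZero I g α)
    (hFε : ∀ C : Set 𝓧, IsCompact C → TendstoUniformlyOn Fε F (𝓝[>] 0) C)
    (hFε_bdd : ∃ b : ℝ, ∀ ε ∈ Set.Ioo (0 : ℝ) 1, ∀ x, b ≤ Fε ε x) :
    Tendsto (fun ε : ℝ => -(ε : EReal) * ENNReal.log (INS.secondMoment μ g Fε α ε))
      (𝓝[>] 0) (𝓝 (INS.V I F α)) := by
  refine INS.tendsto_neg_mul_log (fun r hr => ?_) fun r hr => ?_
  · obtain ⟨s, hrs, hs⟩ := EReal.lt_iff_exists_real_btwn.1 hr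
    filter_upwards [INS.eventually_weightedMoment_le hα_one hα_anti hα_nonneg hμ hg hμg hLDP hI hF
      hρ hFε hFε_bdd hs, INS.eventually_natCast_mul_exp_le
        (Fintype.card (Equiv.Perm (Fin K))) (EReal.coe_lt_coe_iff.1 hrs), self_mem_nhdsWithin]
      with ε h1 h2 hε
    exact (INS.secondMoment_le_weightedMoment (hμ ε hε) (hg ε hε) (hμg ε hε)
      (hFε_meas ε hε)).trans ((mul_le_mul_right h1 _).trans h2)
  · filter_upwards [INS.eventually_le_weightedMoment hα_one hα_anti hα_nonneg hμ hg hμg hLDP hI hF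
      hρ hFε hr, self_mem_nhdsWithin] with ε h1 hε
    exact h1.trans (INS.weightedMoment_le_secondMoment (hμ ε hε) (hg ε hε) (hμg ε hε)
      (hFε_meas ε hε))
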